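/- Let $M$ be a finite-dimensional smooth manifold with a smooth torsion-free affine connection $\nabla$ such that for every $x\in M$ the exponential map $\exp_x$ is defined on all of $T_xM$ and maps onto $M$. For a curve $\gamma:[0,1]\to M$ let $\tau_{\gamma,t}:T_{\gamma(0)}M\to T_{\gamma(t)}M$ be the parallel transport along $\gamma$, and for a bilinear form $G$ on $T_{\gamma(t)}M$ put $(\tau_{\gamma,t}^*G)(u,v)=G(\tau_{\gamma,t}u,\tau_{\gamma,t}v)$. For bilinear forms, $F\preceq G$ means $F(u,u)\le G(u,u)$ for all $u$. Let $C\subseteq M$ be an open geodesically convex set (every geodesic with end points in $C$ stays in $C$), let $\sigma\ge 0$, and let $f:C\to\mathbb R$ be a smooth $\sigma$-self-concordant function. This means: $f$ is convex along geodesics; its epigraph is closed in $M\times\mathbb R$; its Hessian $Hf=\nabla Df$ is positive definite at every point of $C$; and $|(\nabla_vHf)(u,u)|\le 2\sigma\, Hf_x(v,v)^{1/2}Hf_x(u,u)$ for all $x\in C$ and $u,v\in T_xM$. Write $\|u\|_{f,x}=Hf_x(u,u)^{1/2}$, and let the Dikin ellipsoid $W^0(x;r)$ be the set of end points $\eta(1)$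 of the geodesics $\eta:[0,1]\to C$ with $\eta(0)=x$ and $\|\dot\eta(0)\|_{f,x}<r$ (with $1/\sigma=\infty$ if $\sigma=0$). **Proposition.** Let $\gamma:[0,1]\to C$ be a geodesic with $\gamma(1)\in W^0(\gamma(0);1/\sigma)$, where $\gamma$ is itself one of the geodesics that witness this membership; that is, $\sigma N<1$ for $N:=\|\dot\gamma(0)\|_{f,\gamma(0)}$. Then $$(1-\sigma N)^2\,Hf_{\gamma(0)}\ \preceq\ \tau_{\gamma,1}^*Hf_{\gamma(1)}\ \preceq\ \frac{1}{(1-\sigma N)^2}\,Hf_{\gamma(0)}.$$ Moreover, the form $\int_0^1\tau_{\gamma,t}^*Hf_{\gamma(t)}\,dt$ is defined (for all $u,v\in T_{\gamma(0)}M$ the function $t\mapsto(\tau_{\gamma,t}^*Hf_{\gamma(t)})(u,v)$ is integrable on $[0,1]$), and $$\Bigl(1-\sigma N+\tfrac13\sigma^2N^2\Bigr)Hf_{\gamma(0)}\ \preceq\ \int_0^1\tau_{\gamma,t}^*Hf_{\gamma(t)}\,dt\ \preceq\ \frac{1}{1-\sigma N}\,Hf_{\gamma(0)}.$$ -/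

import Mathlib

open Set MeasureTheory
open scoped Manifold ContDiff Topology ENNReal

noncomputable section

namespace SelfConc

/-- An affine connection `∇` on the tangent bundle of a manifold `M` modelled on `E`.
In Mathlib's argument order `∇_X Y` at `x` is `cov Y x (X x)`. -/
abbrev AffineConnection (E : Type*) [NormedAddCommGroup E] [NormedSpace ℝ E]
    (M : Type*) [TopologicalSpace M] [ChartedSpace E M] [IsManifold 𝓘(ℝ, E) ∞ M] :=
  CovariantDerivative 𝓘(ℝ, E) E (TangentSpace 𝓘(ℝ, E) : M → Type _)

variable {E : Type*} [NormedAddCommGroup E] [NormedSpace ℝ E]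
  {M : Type*} [TopologicalSpace M] [ChartedSpace E M] [IsManifold 𝓘(ℝ, E) ∞ M]

/-- `∇` is torsion-free: `∇_X Y - ∇_Y X = [X, Y]`. -/
def IsTorsionFree (cov : AffineConnection E M) : Prop :=
  ∀ (X Y : ∀ x : M, TangentSpace 𝓘(ℝ, E) x) (x : M),
    MDifferentiableAt 𝓘(ℝ, E) 𝓘(ℝ, E).tangent
      (fun y => (⟨y, X y⟩ : TangentBundle 𝓘(ℝ, E) M)) x →
    MDifferentiableAt 𝓘(ℝ, E) 𝓘(ℝ, E).tangent
      (fun y => (⟨y, Y y⟩ : TangentBundle 𝓘(ℝ, E) M)) x →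
    cov Y x (X x) - cov X x (Y x) = VectorField.mlieBracket 𝓘(ℝ, E) X Y x

/-! ### Curves, parallel fields, geodesics, parallel transport -/

/-- The velocity `γ̇(t)` of a curve `γ` defined on `s ⊆ ℝ`. -/
def velocity (γ : ℝ → M) (s : Set ℝ) (t : ℝ) : TangentSpace 𝓘(ℝ, E) (γ t) :=
  mfderivWithin 𝓘(ℝ, ℝ) 𝓘(ℝ, E) γ s t (1 : ℝ)

/-- The covariant derivative `(DV/dt)(t)` of a vector field `V` along a curve `γ`.
Let `∂₁, …, ∂ₙ` be the coordinate fields of the preferred chart at `γ t`, and write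
`V r = ∑ Vⁱ(r) ∂ᵢ`. Then `DV/dt = ∑ (Vⁱ)'(t) ∂ᵢ + ∑ Vⁱ(t) ∇_{γ̇(t)} ∂ᵢ`: the first term below is
the first sum, and `FiberBundle.extend E (V t)` is the field `∑ Vⁱ(t) ∂ᵢ` with constant
coefficients. -/
def covDerivAlong (cov : AffineConnection E M) (γ : ℝ → M) (s : Set ℝ)
    (V : ∀ t, TangentSpace 𝓘(ℝ, E) (γ t)) (t : ℝ) : TangentSpace 𝓘(ℝ, E) (γ t) :=
  (trivializationAt E (TangentSpace 𝓘(ℝ, E) : M → Type _) (γ t)).symm (γ t)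
      (derivWithin (fun r =>
        (trivializationAt E (TangentSpace 𝓘(ℝ, E) : M → Type _) (γ t)
          (⟨γ r, V r⟩ : TangentBundle 𝓘(ℝ, E) M)).2) s t)
    + cov (FiberBundle.extend E (V t)) (γ t) (velocity γ s t)

/-- `V` is a smooth vector field along `γ : s → M` which is parallel. -/
def IsParallelAlong (cov : AffineConnection E M) (γ : ℝ → M) (s : Set ℝ)
    (V : ∀ t, TangentSpace 𝓘(ℝ, E) (γ t)) : Prop :=
  ContMDiffOn 𝓘(ℝ, ℝ) 𝓘(ℝ, E).tangent ∞
      (fun t => (⟨γ t, V t⟩ : TangentBundle 𝓘(ℝ, E) M)) s ∧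
    ∀ t ∈ s, covDerivAlong cov γ s V t = 0

/-- `γ : [a, b] → M` is a geodesic: a smooth curve whose velocity is parallel along it. -/
def IsGeodesic (cov : AffineConnection E M) (γ : ℝ → M) (a b : ℝ) : Prop :=
  ContMDiffOn 𝓘(ℝ, ℝ) 𝓘(ℝ, E) ∞ γ (Icc a b) ∧
    IsParallelAlong cov γ (Icc a b) (velocity γ (Icc a b))

/-- `τ t : T_{γ(a)} → T_{γ(t)}`, `t ∈ [a, b]`, carries each `u` along the parallel field along
`γ : [a, b] → M` that starts at `u`. -/
def IsParallelTransport (cov : AffineConnection E M) (γ : ℝ → M) (a b : ℝ)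
    (τ : ∀ t, TangentSpace 𝓘(ℝ, E) (γ a) →ₗ[ℝ] TangentSpace 𝓘(ℝ, E) (γ t)) : Prop :=
  τ a = LinearMap.id ∧ ∀ u, IsParallelAlong cov γ (Icc a b) (fun t => τ t u)

open Classical in
/-- The parallel transport `τ_{γ,t} : T_{γ(a)} → T_{γ(t)}` along a curve `γ : [a, b] → M`. For a
smooth curve it exists and is unique for `t ∈ [a, b]`; where it does not exist the value is `0`. -/
def parallelTransport (cov : AffineConnection E M) (γ : ℝ → M) (a b : ℝ) :
    ∀ t, TangentSpace 𝓘(ℝ, E) (γ a) →ₗ[ℝ] TangentSpace 𝓘(ℝ, E) (γ t) :=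
  if h : ∃ τ, IsParallelTransport cov γ a b τ then h.choose else fun _ => 0

/-- For every `x`, the exponential map `exp_x` is defined on all of `T_x`. -/
def ExpDefined (cov : AffineConnection E M) : Prop :=
  ∀ (x : M) (u : TangentSpace 𝓘(ℝ, E) x), ∃ γ : ℝ → M, IsGeodesic cov γ 0 1 ∧
    (⟨γ 0, velocity γ (Icc 0 1) 0⟩ : TangentBundle 𝓘(ℝ, E) M) = ⟨x, u⟩

/-- For every `x`, the exponential map `exp_x` is onto `M`. -/
def ExpSurjective (cov : AffineConnection E M) : Prop :=
  ∀ x y : M, ∃ γ : ℝ → M, IsGeodesic cov γ 0 1 ∧ γ 0 = x ∧ γ 1 = y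

/-! ### Covariant derivatives of tensors, the Hessian -/

/-- `(∇_u α)(v) = u(α(Y)) - α(∇_u Y)` for a `(0,1)`-tensor field `α`, where the vector field `Y` is
the standard local extension of `v`. -/
def covDerivOne (cov : AffineConnection E M) (α : ∀ x : M, TangentSpace 𝓘(ℝ, E) x → ℝ) (x : M)
    (u v : TangentSpace 𝓘(ℝ, E) x) : ℝ :=
  mvfderiv 𝓘(ℝ, E) (fun y => α y (FiberBundle.extend E v y)) x u
    - α x (cov (FiberBundle.extend E v) x u)

/-- `(∇_u G)(v, w) = u(G(Y, Z)) - G(∇_u Y, Z) - G(Y, ∇_u Z)` for a `(0,2)`-tensor field `G`, where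
the vector fields `Y`, `Z` are the standard local extensions of `v`, `w`. -/
def covDerivTwo (cov : AffineConnection E M)
    (G : ∀ x : M, TangentSpace 𝓘(ℝ, E) x → TangentSpace 𝓘(ℝ, E) x → ℝ) (x : M)
    (u v w : TangentSpace 𝓘(ℝ, E) x) : ℝ :=
  mvfderiv 𝓘(ℝ, E) (fun y => G y (FiberBundle.extend E v y) (FiberBundle.extend E w y)) x u
    - G x (cov (FiberBundle.extend E v) x u) w
    - G x v (cov (FiberBundle.extend E w) x u)

/-- The Hessian `Hf_x(u, v) = (∇_u Df)(v)`. -/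
def hessian (cov : AffineConnection E M) (f : M → ℝ) (x : M)
    (u v : TangentSpace 𝓘(ℝ, E) x) : ℝ :=
  covDerivOne cov (fun y w => mvfderiv 𝓘(ℝ, E) f y w) x u v

/-- The local norm `‖u‖_{f,x} = Hf_x(u, u)^{1/2}`. -/
def localNorm (cov : AffineConnection E M) (f : M → ℝ) (x : M)
    (u : TangentSpace 𝓘(ℝ, E) x) : ℝ :=
  √(hessian cov f x u u)

/-! ### Convexity and self-concordance -/

/-- `C` is geodesically convex: every geodesic with end points in `C` stays in `C`. -/
def IsGeodConvex (cov : AffineConnection E M) (C : Set M) : Prop :=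
  ∀ (a b : ℝ) (γ : ℝ → M), a < b → IsGeodesic cov γ a b → γ a ∈ C → γ b ∈ C →
    ∀ t ∈ Icc a b, γ t ∈ C

/-- `f : C → ℝ` is convex along every geodesic in `C`. -/
def IsGeodConvexFun (cov : AffineConnection E M) (C : Set M) (f : M → ℝ) : Prop :=
  ∀ (a b : ℝ) (γ : ℝ → M), a < b → IsGeodesic cov γ a b → MapsTo γ (Icc a b) C →
    ConvexOn ℝ (Icc a b) (f ∘ γ)

/-- `f : C → ℝ` is `σ`-self-concordant: smooth, convex, closed (the epigraph of `f`, extended by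
`+∞` outside `C`, is closed in `M × ℝ`), nondegenerate, and
`|(∇_v Hf)(u, u)| ≤ 2 σ Hf(v, v)^{1/2} Hf(u, u)`. Values of `f` outside `C` play no role when `C` is
open. -/
structure IsSelfConcordant (cov : AffineConnection E M) (C : Set M) (f : M → ℝ) (σ : ℝ) :
    Prop where
  smooth : ContMDiffOn 𝓘(ℝ, E) 𝓘(ℝ, ℝ) ∞ f C
  convex : IsGeodConvexFun cov C f
  closed : IsClosed {p : M × ℝ | p.1 ∈ C ∧ f p.1 ≤ p.2}
  nondegenerate : ∀ x ∈ C, ∀ u : TangentSpace 𝓘(ℝ, E) x, u ≠ 0 → 0 < hessian cov f x u u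
  bound : ∀ x ∈ C, ∀ u v : TangentSpace 𝓘(ℝ, E) x,
    |covDerivTwo cov (hessian cov f) x v u u| ≤
      2 * σ * √(hessian cov f x v v) * hessian cov f x u u

/-- The Dikin ellipsoid `W⁰(x; r)`: the end points of the geodesics `γ : [0, 1] → C` with
`γ(0) = x` and `‖γ̇(0)‖_{f,x} < r`. The radius may be `∞`. -/
def dikinEllipsoid (cov : AffineConnection E M) (C : Set M) (f : M → ℝ) (x : M) (r : ℝ≥0∞) :
    Set M :=
  {y | ∃ γ : ℝ → M, IsGeodesic cov γ 0 1 ∧ MapsTo γ (Icc 0 1) C ∧ γ 0 = x ∧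
    ENNReal.ofReal (localNorm cov f (γ 0) (velocity γ (Icc 0 1) 0)) < r ∧ γ 1 = y}

/-! ### Bilinear forms -/

/-- `F ≼ G`: `F(u, u) ≤ G(u, u)` for all `u`. -/
def FormLE {U : Type*} (F G : U → U → ℝ) : Prop := ∀ u, F u u ≤ G u u

/-- The pulled back form `τ_{γ,t}^* Hf_{γ(t)}` on `T_{γ(0)}`, for a curve `γ : [0, 1] → M`. -/
def transportedHessian (cov : AffineConnection E M) (f : M → ℝ) (γ : ℝ → M) (t : ℝ)
    (u v : TangentSpace 𝓘(ℝ, E) (γ 0)) : ℝ :=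
  hessian cov f (γ t) (parallelTransport cov γ 0 1 t u) (parallelTransport cov γ 0 1 t v)

end SelfConc

end

noncomputable section

namespace SelfConc

variable {E : Type*} [NormedAddCommGroup E] [NormedSpace ℝ E]
  {M : Type*} [TopologicalSpace M] [ChartedSpace E M] [IsManifold 𝓘(ℝ, E) ∞ M]

/-! Once parallel transport is available, the theorem is one-variable calculus along `γ`. For
parallel fields `V`, `W` the product rule gives `d/dt Hf(V, W) = (∇_γ̇ Hf)(V, W)`
(`hasDerivWithinAt_hessian`), and self-concordance bounds the right-hand side when `V = W`. Take `V
= γ̇`, which is parallel because `γ` is a geodesic. Then `φ = Hf(γ̇, γ̇)` satisfies `|φ'| ≤ 2σ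
φ^{3/2}`, so `φ^{-1/2}` decreases at rate at most `σ` and `‖γ̇(t)‖ ≤ N / (1 - σNt)`
(`sqrt_le_of_abs_deriv_le`). Now take `V = τ_t u`. Then `g = Hf(V, V)` satisfies `|g'| ≤ 2 (σN / (1
- σNt)) g`, so `g(t)` lies between `(1 - σNt)^2 g(0)` and `(1 - σNt)^{-2} g(0)`
(`bounds_of_abs_deriv_le`). The time `t = 1` gives the first pair of bounds, integration over `[0,
1]` the second.

The remaining work is to justify this calculus. The connection and the Hessian are written in charts
through Christoffel symbols. Parallel transport, defined by choice, must be shown to exist along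
`γ`: it solves a linear equation, solved on short intervals, glued by compactness, and smooth by
bootstrapping (`isParallelTransport_parallelTransport`). Uniqueness is not needed, since the
estimates hold for any transport. -/

/-- Coordinates of a tangent vector at `y` in the preferred chart at `x₀`. -/
def coordAt (x₀ y : M) : TangentSpace 𝓘(ℝ, E) y →L[ℝ] E :=
  (trivializationAt E (TangentSpace 𝓘(ℝ, E) : M → Type _) x₀).continuousLinearMapAt ℝ y

/-- The vector field with constant coordinates `w` in the preferred chart at `x₀`. -/
def constField (x₀ : M) (w : E) (y : M) : TangentSpace 𝓘(ℝ, E) y :=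
  (trivializationAt E (TangentSpace 𝓘(ℝ, E) : M → Type _) x₀).symm y w

/-- `constField` as a linear map in the coordinates. -/
def frameAt (x₀ y : M) : E →L[ℝ] TangentSpace 𝓘(ℝ, E) y :=
  (trivializationAt E (TangentSpace 𝓘(ℝ, E) : M → Type _) x₀).symmL ℝ y

lemma contMDiffVectorBundle_tangentSpace :
    ContMDiffVectorBundle ∞ E (TangentSpace 𝓘(ℝ, E) : M → Type _) 𝓘(ℝ, E) :=
  -- The tangent bundle is one degree less smooth than the manifold; at `∞` nothing is lost, as `∞ +
  -- 1` is `∞`.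
  have : IsManifold 𝓘(ℝ, E) ((∞ : ℕ∞ω) + 1) M := inferInstanceAs (IsManifold 𝓘(ℝ, E) ∞ M)
  TangentBundle.contMDiffVectorBundle

/-! ### Vector fields and differentials in a chart. -/

section Coordinates

variable {x₀ y : M}

lemma coordAt_apply (hy : y ∈ (chartAt E x₀).source) (v : TangentSpace 𝓘(ℝ, E) y) :
    coordAt x₀ y v = (trivializationAt E (TangentSpace 𝓘(ℝ, E) : M → Type _) x₀ ⟨y, v⟩).2 :=
  Bundle.Trivialization.continuousLinearMapAt_apply_of_mem ℝ _ hy v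

lemma coordAt_of_notMem (hy : y ∉ (chartAt E x₀).source) :
    (coordAt x₀ y : TangentSpace 𝓘(ℝ, E) y →L[ℝ] E) = 0 := by
  ext v
  have := Bundle.Trivialization.linearMapAt_def_of_notMem (R := ℝ)
    (trivializationAt E (TangentSpace 𝓘(ℝ, E) : M → Type _) x₀) hy
  exact congr($this v)

lemma frameAt_apply (hy : y ∈ (chartAt E x₀).source) (w : E) :
    frameAt x₀ y w = constField x₀ w y :=
  Bundle.Trivialization.symmL_apply _ hy w

lemma coordAt_frameAt (hy : y ∈ (chartAt E x₀).source) (w : E) :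
    coordAt x₀ y (frameAt x₀ y w) = w :=
  Bundle.Trivialization.continuousLinearMapAt_symmL _ hy w

lemma coordAt_constField (hy : y ∈ (chartAt E x₀).source) (w : E) :
    coordAt x₀ y (constField x₀ w y) = w := by
  rw [← frameAt_apply hy, coordAt_frameAt hy]

lemma frameAt_coordAt (hy : y ∈ (chartAt E x₀).source) (v : TangentSpace 𝓘(ℝ, E) y) :
    frameAt x₀ y (coordAt x₀ y v) = v :=
  Bundle.Trivialization.symmL_continuousLinearMapAt _ hy v

lemma constField_coordAt (hy : y ∈ (chartAt E x₀).source) (v : TangentSpace 𝓘(ℝ, E) y) :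
    constField x₀ (coordAt x₀ y v) y = v := by
  rw [← frameAt_apply hy, frameAt_coordAt hy]

lemma coordAt_injective (hy : y ∈ (chartAt E x₀).source) :
    Function.Injective (coordAt x₀ y : TangentSpace 𝓘(ℝ, E) y → E) :=
  Function.LeftInverse.injective (frameAt_coordAt hy)

/-- This links the standard extensions in the definitions of the Hessian and of `covDerivAlong` to
coordinate frames. The chart must be the preferred one at `y` itself. -/
lemma extend_eq_constField (v : TangentSpace 𝓘(ℝ, E) y) :
    FiberBundle.extend E v = constField y (coordAt y y v) := by
  rw [coordAt_apply (mem_chart_source E y)]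
  rfl

omit [NormedSpace ℝ E] [IsManifold 𝓘(ℝ, E) ∞ M] in
lemma eventually_mem_chart_source (hy : y ∈ (chartAt E x₀).source) :
    ∀ᶠ z in 𝓝 y, z ∈ (chartAt E x₀).source :=
  (chartAt E x₀).open_source.mem_nhds hy

lemma contMDiffAt_iff_coordAt (hy : y ∈ (chartAt E x₀).source)
    (X : ∀ z : M, TangentSpace 𝓘(ℝ, E) z) :
    ContMDiffAt 𝓘(ℝ, E) 𝓘(ℝ, E).tangent ∞
        (fun z => (⟨z, X z⟩ : TangentBundle 𝓘(ℝ, E) M)) y ↔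
      ContMDiffAt 𝓘(ℝ, E) 𝓘(ℝ, E) ∞ (fun z => coordAt x₀ z (X z)) y := by
  have := contMDiffVectorBundle_tangentSpace (E := E) (M := M)
  refine (Bundle.Trivialization.contMDiffAt_section_iff
    (trivializationAt E (TangentSpace 𝓘(ℝ, E) : M → Type _) x₀) hy).trans
    (Filter.EventuallyEq.contMDiffAt_iff ?_)
  filter_upwards [eventually_mem_chart_source hy] with z hz
  rw [coordAt_apply hz]

lemma mdifferentiableAt_iff_coordAt (hy : y ∈ (chartAt E x₀).source)
    (X : ∀ z : M, TangentSpace 𝓘(ℝ, E) z) :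
    MDifferentiableAt 𝓘(ℝ, E) 𝓘(ℝ, E).tangent
        (fun z => (⟨z, X z⟩ : TangentBundle 𝓘(ℝ, E) M)) y ↔
      MDifferentiableAt 𝓘(ℝ, E) 𝓘(ℝ, E) (fun z => coordAt x₀ z (X z)) y := by
  refine (Bundle.Trivialization.mdifferentiableAt_section_iff 𝓘(ℝ, E)
    (trivializationAt E (TangentSpace 𝓘(ℝ, E) : M → Type _) x₀) X hy).trans
    (Filter.EventuallyEq.mdifferentiableAt_iff ?_)
  filter_upwards [eventually_mem_chart_source hy] with z hz
  rw [coordAt_apply hz]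

lemma contMDiffAt_constField (hy : y ∈ (chartAt E x₀).source) (w : E) :
    ContMDiffAt 𝓘(ℝ, E) 𝓘(ℝ, E).tangent ∞
      (fun z => (⟨z, constField x₀ w z⟩ : TangentBundle 𝓘(ℝ, E) M)) y := by
  rw [contMDiffAt_iff_coordAt hy]
  refine (contMDiffAt_const (c := w)).congr_of_eventuallyEq ?_
  filter_upwards [eventually_mem_chart_source hy] with z hz
  rw [coordAt_constField hz]

lemma mdifferentiableAt_constField (hy : y ∈ (chartAt E x₀).source) (w : E) :
    MDifferentiableAt 𝓘(ℝ, E) 𝓘(ℝ, E).tangent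
      (fun z => (⟨z, constField x₀ w z⟩ : TangentBundle 𝓘(ℝ, E) M)) y :=
  (contMDiffAt_constField hy w).mdifferentiableAt (by simp)

/-- The differential of a function, in the coordinates of the chart at `x₀`. -/
lemma mvfderiv_eq_fderiv {F : Type*} [NormedAddCommGroup F] [NormedSpace ℝ F]
    (hy : y ∈ (chartAt E x₀).source) {g : M → F}
    (hg : MDifferentiableAt 𝓘(ℝ, E) 𝓘(ℝ, F) g y) (v : TangentSpace 𝓘(ℝ, E) y) :
    mvfderiv 𝓘(ℝ, E) g y v =
      fderiv ℝ (g ∘ (chartAt E x₀).symm) (chartAt E x₀ y) (coordAt x₀ y v) := by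
  have hc : coordAt x₀ y v = mfderiv 𝓘(ℝ, E) 𝓘(ℝ, E) (chartAt E x₀) y v := by
    rw [coordAt, TangentBundle.continuousLinearMapAt_trivializationAt hy]
    rfl
  have hφ : MDifferentiableAt 𝓘(ℝ, E) 𝓘(ℝ, E) (chartAt E x₀) y :=
    mdifferentiableAt_extChartAt (I := 𝓘(ℝ, E)) hy
  have hs : MDifferentiableAt 𝓘(ℝ, E) 𝓘(ℝ, F) (g ∘ (chartAt E x₀).symm) (chartAt E x₀ y) := by
    refine MDifferentiableAt.comp (I' := 𝓘(ℝ, E)) _ ?_ ?_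
    · rwa [(chartAt E x₀).left_inv hy]
    · exact (contMDiffOn_chart_symm.contMDiffAt
        ((chartAt E x₀).open_target.mem_nhds ((chartAt E x₀).map_source hy))).mdifferentiableAt
        (n := ∞) (by simp)
  have he : g =ᶠ[𝓝 y] (g ∘ (chartAt E x₀).symm) ∘ chartAt E x₀ := by
    filter_upwards [eventually_mem_chart_source hy] with z hz
    simp [(chartAt E x₀).left_inv hz]
  have h1 := (hs.hasMFDerivAt.comp y hφ.hasMFDerivAt).congr_of_eventuallyEq he
  rw [mvfderiv, h1.mfderiv, hc, mfderiv_eq_fderiv]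
  rfl

end Coordinates

/-! ### Christoffel symbols of the connection. -/

section Christoffel

variable [FiniteDimensional ℝ E] (cov : AffineConnection E M)

/-- The Christoffel symbols of `∇` in the chart at `x₀`, as a bilinear map: the coordinates at `y`
of `∇_a b`, where `a`, `b` stand for vector fields with constant coordinates. -/
def christoffel (x₀ y : M) : E →L[ℝ] E →L[ℝ] E :=
  LinearMap.toContinuousBilinearMap <| LinearMap.mk₂ ℝ
    (fun a b => coordAt x₀ y (cov (constField x₀ b) y (frameAt x₀ y a)))
    (fun a a' b => by simp) (fun c a b => by simp)
    (fun a b b' => by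
      -- Outside the chart domain `coordAt` is zero, so bilinearity holds at every `y` and the
      -- symbols are defined globally.
      by_cases hy : y ∈ (chartAt E x₀).source
      · have h : cov (constField x₀ (b + b')) y = cov (constField x₀ b + constField x₀ b') y := by
          refine cov.isCovariantDerivativeOnUniv.congr_of_eventuallyEq
            (mdifferentiableAt_constField hy _)
            (mdifferentiableAt_add_section (mdifferentiableAt_constField hy _)
              (mdifferentiableAt_constField hy _)) Filter.univ_mem ?_
          filter_upwards [eventually_mem_chart_source hy] with z hz
          simp [← frameAt_apply hz]
        rw [h, cov.isCovariantDerivativeOnUniv.add (mdifferentiableAt_constField hy _)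
              (mdifferentiableAt_constField hy _)]
        simp
      · simp [coordAt_of_notMem hy])
    (fun c a b => by
      by_cases hy : y ∈ (chartAt E x₀).source
      · have h : cov (constField x₀ (c • b)) y = cov (c • constField x₀ b) y := by
          refine cov.isCovariantDerivativeOnUniv.congr_of_eventuallyEq
            (mdifferentiableAt_constField hy _)
            (MDifferentiableAt.smul_const_section (mdifferentiableAt_constField hy _))
            Filter.univ_mem ?_
          filter_upwards [eventually_mem_chart_source hy] with z hz
          simp [← frameAt_apply hz]
        rw [h, cov.isCovariantDerivativeOnUniv.smul_const _ (mdifferentiableAt_constField hy _)]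
        simp
      · simp [coordAt_of_notMem hy])

variable {cov} {x₀ y : M}

lemma christoffel_apply (a b : E) : christoffel cov x₀ y a b =
    coordAt x₀ y (cov (constField x₀ b) y (frameAt x₀ y a)) :=
  rfl

/-- The covariant derivative of a vector field, in the coordinates of the chart at `x₀`. -/
lemma coordAt_cov (hy : y ∈ (chartAt E x₀).source) {X : ∀ z : M, TangentSpace 𝓘(ℝ, E) z}
    (hX : MDifferentiableAt 𝓘(ℝ, E) 𝓘(ℝ, E).tangent
      (fun z => (⟨z, X z⟩ : TangentBundle 𝓘(ℝ, E) M)) y) (u : TangentSpace 𝓘(ℝ, E) y) :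
    coordAt x₀ y (cov X y u) = mvfderiv 𝓘(ℝ, E) (fun z => coordAt x₀ z (X z)) y u +
      christoffel cov x₀ y (coordAt x₀ y u) (coordAt x₀ y (X y)) := by
  -- The Leibniz terms of `∇` and of the coordinate derivative cancel, so their difference depends
  -- only on `X y`. It can therefore be evaluated on the field with constant coordinates, where the
  -- coordinate derivative vanishes.
  have ht : TensorialAt 𝓘(ℝ, E) E
      (fun Y : ∀ z : M, TangentSpace 𝓘(ℝ, E) z =>
        coordAt x₀ y (cov Y y u) - mvfderiv 𝓘(ℝ, E) (fun z => coordAt x₀ z (Y z)) y u) y :=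
    { smul := fun {g Y} hg hY => by
        have h := (mdifferentiableAt_iff_coordAt hy Y).1 hY
        have e : (fun z => coordAt x₀ z ((g • Y) z)) = g • fun z => coordAt x₀ z (Y z) := by
          ext z; simp
        rw [e, mvfderiv_smul hg h, cov.isCovariantDerivativeOnUniv.leibniz hY hg]
        simp
        module
      add := fun {Y Z} hY hZ => by
        have h := (mdifferentiableAt_iff_coordAt hy Y).1 hY
        have h' := (mdifferentiableAt_iff_coordAt hy Z).1 hZ
        have e : (fun z => coordAt x₀ z ((Y + Z) z)) =
            (fun z => coordAt x₀ z (Y z)) + fun z => coordAt x₀ z (Z z) := by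
          ext z; simp
        rw [e, mvfderiv_add h h', cov.isCovariantDerivativeOnUniv.add hY hZ]
        simp
        module }
  have h := ht.pointwise hX (mdifferentiableAt_constField hy (coordAt x₀ y (X y)))
    (constField_coordAt hy _).symm
  have hc : mvfderiv 𝓘(ℝ, E) (fun z => coordAt x₀ z (constField x₀ (coordAt x₀ y (X y)) z)) y
      = 0 := by
    have e : (fun z => coordAt x₀ z (constField x₀ (coordAt x₀ y (X y)) z)) =ᶠ[𝓝 y]
        fun _ => coordAt x₀ y (X y) := by
      filter_upwards [eventually_mem_chart_source hy] with z hz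
      rw [coordAt_constField hz]
    have := (hasMFDerivAt_const (I := 𝓘(ℝ, E)) (I' := 𝓘(ℝ, E))
      (coordAt x₀ y (X y)) y).congr_of_eventuallyEq e
    rw [mvfderiv, this.mfderiv]
    rfl
  simp only [hc] at h
  rw [christoffel_apply, frameAt_coordAt hy]
  simp only [zero_apply, sub_zero] at h
  rw [← h]
  abel

/-- A smooth connection maps vector fields smooth near `y` to fields of endomorphisms smooth
near `y`. -/
lemma contMDiffAt_cov [T2Space M] [CovariantDerivative.ContMDiffCovariantDerivative cov ∞]
    {X : ∀ z : M, TangentSpace 𝓘(ℝ, E) z}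
    {U : Set M} (hU : U ∈ 𝓝 y)
    (hX : ∀ z ∈ U, ContMDiffAt 𝓘(ℝ, E) 𝓘(ℝ, E).tangent ∞
      (fun z => (⟨z, X z⟩ : TangentBundle 𝓘(ℝ, E) M)) z) :
    ContMDiffAt 𝓘(ℝ, E) (𝓘(ℝ, E).prod 𝓘(ℝ, E →L[ℝ] E)) ∞
      (fun z => (⟨z, cov X z⟩ : Bundle.TotalSpace (E →L[ℝ] E)
        fun z : M => TangentSpace 𝓘(ℝ, E) z →L[ℝ] TangentSpace 𝓘(ℝ, E) z)) y := by
  have hvb := contMDiffVectorBundle_tangentSpace (E := E) (M := M)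
  -- The smoothness of the connection is applied to a globally smooth field, so `X` is cut off by a
  -- bump function supported in `U`. Near `y` the bump is `1`, and locality of `∇` removes it again.
  obtain ⟨g, -, hg⟩ := (SmoothBumpFunction.nhds_basis_tsupport (I := 𝓘(ℝ, E)) y).mem_iff.1 hU
  have hgX : ContMDiff 𝓘(ℝ, E) 𝓘(ℝ, E).tangent ∞
      (fun z => (⟨z, (g : M → ℝ) z • X z⟩ : TangentBundle 𝓘(ℝ, E) M)) := by
    intro z
    by_cases hz : z ∈ tsupport g
    · exact ContMDiffAt.smul_section g.contMDiffAt (hX z (hg hz))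
    · refine (Bundle.contMDiff_zeroSection ℝ
        (TangentSpace 𝓘(ℝ, E) : M → Type _) z).congr_of_eventuallyEq ?_
      filter_upwards [(isClosed_tsupport g).isOpen_compl.mem_nhds hz] with w hw
      have : g w = 0 := image_eq_zero_of_notMem_tsupport hw
      simp [this, Bundle.zeroSection]
  have h := (CovariantDerivative.ContMDiffCovariantDerivative.contMDiff
    (cov := cov) (k := ∞)).contMDiff (σ := fun z => (g : M → ℝ) z • X z) hgX.contMDiffOn
  refine ((h y (mem_univ y)).contMDiffAt Filter.univ_mem).congr_of_eventuallyEq ?_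
  filter_upwards [g.eventuallyEq_one.eventually_nhds, eventually_mem_nhds_iff.2 hU] with z hz hzU
  have : cov X z = cov (fun z => (g : M → ℝ) z • X z) z := by
    refine cov.isCovariantDerivativeOnUniv.congr_of_eventuallyEq
      ((hX z (mem_of_mem_nhds hzU)).mdifferentiableAt (by simp))
      ((hgX z).mdifferentiableAt (by simp)) Filter.univ_mem ?_
    filter_upwards [hz] with w hw
    simp [hw]
  rw [this]

lemma contMDiffAt_christoffel_apply [T2Space M]
    [CovariantDerivative.ContMDiffCovariantDerivative cov ∞]
    (hy : y ∈ (chartAt E x₀).source) (a b : E) :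
    ContMDiffAt 𝓘(ℝ, E) 𝓘(ℝ, E) ∞ (fun z => christoffel cov x₀ z a b) y := by
  have hvb := contMDiffVectorBundle_tangentSpace (E := E) (M := M)
  have h := contMDiffAt_cov (cov := cov) (eventually_mem_chart_source hy)
    fun z hz => contMDiffAt_constField hz b
  have h2 := (contMDiffAt_iff_coordAt hy _).1
    (ContMDiffAt.clm_bundle_apply h (contMDiffAt_constField hy a))
  refine h2.congr_of_eventuallyEq ?_
  filter_upwards [eventually_mem_chart_source hy] with z hz
  rw [christoffel_apply, frameAt_apply hz]

/-- The Christoffel symbols are smooth in the chart. -/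
lemma contDiffOn_christoffel [T2Space M]
    [CovariantDerivative.ContMDiffCovariantDerivative cov ∞] (x₀ : M) :
    ContDiffOn ℝ ∞ (fun q => christoffel cov x₀ ((chartAt E x₀).symm q))
      (chartAt E x₀).target := by
  refine contDiffOn_clm_apply.2 fun a => contDiffOn_clm_apply.2 fun b q hq => ?_
  have h1 := contMDiffAt_christoffel_apply (cov := cov) ((chartAt E x₀).map_target hq) a b
  have h2 : ContMDiffAt 𝓘(ℝ, E) 𝓘(ℝ, E) ∞ (chartAt E x₀).symm q :=
    contMDiffOn_chart_symm.contMDiffAt ((chartAt E x₀).open_target.mem_nhds hq)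
  exact (contMDiffAt_iff_contDiffAt.1 (h1.comp q h2)).contDiffWithinAt

end Christoffel

/-! ### The Hessian and its covariant derivative in coordinates. -/

section Hessian

variable [FiniteDimensional ℝ E] (cov : AffineConnection E M) {C : Set M} {f : M → ℝ}

/-- The Hessian of `f` at the point with coordinates `q` in the chart at `x₀`. -/
def hessianCoord (f : M → ℝ) (x₀ : M) (q : E) : E →L[ℝ] E →L[ℝ] ℝ :=
  fderiv ℝ (fderiv ℝ (f ∘ (chartAt E x₀).symm)) q -
    (ContinuousLinearMap.compL ℝ E E ℝ (fderiv ℝ (f ∘ (chartAt E x₀).symm) q)) ∘L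
      christoffel cov x₀ ((chartAt E x₀).symm q)

variable {cov} {x₀ y : M}

lemma hessianCoord_apply (q a b : E) : hessianCoord cov f x₀ q a b =
    fderiv ℝ (fderiv ℝ (f ∘ (chartAt E x₀).symm)) q a b -
      fderiv ℝ (f ∘ (chartAt E x₀).symm) q (christoffel cov x₀ ((chartAt E x₀).symm q) a b) :=
  rfl

omit [FiniteDimensional ℝ E] in
lemma contDiffAt_comp_chart_symm (hCo : IsOpen C) (hf : ContMDiffOn 𝓘(ℝ, E) 𝓘(ℝ, ℝ) ∞ f C)
    (hy : y ∈ (chartAt E x₀).source) (hyC : y ∈ C) :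
    ContDiffAt ℝ ∞ (f ∘ (chartAt E x₀).symm) (chartAt E x₀ y) := by
  rw [← contMDiffAt_iff_contDiffAt]
  refine ContMDiffAt.comp (I' := 𝓘(ℝ, E)) _ ?_ (contMDiffOn_chart_symm.contMDiffAt
    ((chartAt E x₀).open_target.mem_nhds ((chartAt E x₀).map_source hy)))
  rw [(chartAt E x₀).left_inv hy]
  exact hf.contMDiffAt (hCo.mem_nhds hyC)

omit [FiniteDimensional ℝ E] in
lemma contDiffAt_fderiv_comp_chart_symm (hCo : IsOpen C)
    (hf : ContMDiffOn 𝓘(ℝ, E) 𝓘(ℝ, ℝ) ∞ f C)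
    (hy : y ∈ (chartAt E x₀).source) (hyC : y ∈ C) :
    ContDiffAt ℝ ∞ (fderiv ℝ (f ∘ (chartAt E x₀).symm)) (chartAt E x₀ y) :=
  (contDiffAt_comp_chart_symm hCo hf hy hyC).fderiv_right le_rfl

omit [FiniteDimensional ℝ E] in
-- The identity is needed for germs, not only at `y`, because the Hessian differentiates it once
-- more.
lemma mvfderiv_eventuallyEq (hCo : IsOpen C) (hf : ContMDiffOn 𝓘(ℝ, E) 𝓘(ℝ, ℝ) ∞ f C)
    (hy : y ∈ (chartAt E x₀).source) (hyC : y ∈ C) (X : ∀ z : M, TangentSpace 𝓘(ℝ, E) z) :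
    (fun z => mvfderiv 𝓘(ℝ, E) f z (X z)) =ᶠ[𝓝 y] fun z =>
      fderiv ℝ (f ∘ (chartAt E x₀).symm) (chartAt E x₀ z) (coordAt x₀ z (X z)) := by
  filter_upwards [eventually_mem_chart_source hy, hCo.mem_nhds hyC] with z hz hzC
  exact mvfderiv_eq_fderiv hz
    ((hf.contMDiffAt (hCo.mem_nhds hzC)).mdifferentiableAt (by simp)) _

omit [FiniteDimensional ℝ E] in
lemma mdifferentiableAt_mvfderiv_apply (hCo : IsOpen C)
    (hf : ContMDiffOn 𝓘(ℝ, E) 𝓘(ℝ, ℝ) ∞ f C) (hyC : y ∈ C)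
    {X : ∀ z : M, TangentSpace 𝓘(ℝ, E) z}
    (hX : MDifferentiableAt 𝓘(ℝ, E) 𝓘(ℝ, E).tangent
      (fun z => (⟨z, X z⟩ : TangentBundle 𝓘(ℝ, E) M)) y) :
    MDifferentiableAt 𝓘(ℝ, E) 𝓘(ℝ, ℝ) (fun z => mvfderiv 𝓘(ℝ, E) f z (X z)) y := by
  have hy := mem_chart_source E y
  refine (mvfderiv_eventuallyEq hCo hf hy hyC X).mdifferentiableAt_iff.2 ?_
  refine MDifferentiableAt.clm_apply ?_ ((mdifferentiableAt_iff_coordAt hy X).1 hX)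
  exact MDifferentiableAt.comp (I' := 𝓘(ℝ, E)) y
    ((contDiffAt_fderiv_comp_chart_symm hCo hf hy hyC).differentiableAt
      (by simp)).mdifferentiableAt (mdifferentiableAt_extChartAt (I := 𝓘(ℝ, E)) hy)

/-- In the definition of the Hessian, any extension of the second vector may be used. -/
lemma hessian_eq (hCo : IsOpen C) (hf : ContMDiffOn 𝓘(ℝ, E) 𝓘(ℝ, ℝ) ∞ f C) (hyC : y ∈ C)
    {X : ∀ z : M, TangentSpace 𝓘(ℝ, E) z}
    (hX : MDifferentiableAt 𝓘(ℝ, E) 𝓘(ℝ, E).tangent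
      (fun z => (⟨z, X z⟩ : TangentBundle 𝓘(ℝ, E) M)) y) (u : TangentSpace 𝓘(ℝ, E) y) :
    hessian cov f y u (X y) = mvfderiv 𝓘(ℝ, E) (fun z => mvfderiv 𝓘(ℝ, E) f z (X z)) y u -
      mvfderiv 𝓘(ℝ, E) f y (cov X y u) := by
  -- The term `u(g) Df(Y)` produced by the outer derivative is cancelled by the Leibniz term of `∇_u
  -- (gY)`.
  have ht : TensorialAt 𝓘(ℝ, E) E
      (fun Y : ∀ z : M, TangentSpace 𝓘(ℝ, E) z =>
        mvfderiv 𝓘(ℝ, E) (fun z => mvfderiv 𝓘(ℝ, E) f z (Y z)) y u -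
          mvfderiv 𝓘(ℝ, E) f y (cov Y y u)) y :=
    { smul := fun {g Y} hg hY => by
        have e : (fun z => mvfderiv 𝓘(ℝ, E) f z ((g • Y) z)) =
            g • fun z => mvfderiv 𝓘(ℝ, E) f z (Y z) := by
          ext z; simp
        rw [e, mvfderiv_smul hg (mdifferentiableAt_mvfderiv_apply hCo hf hyC hY),
          cov.isCovariantDerivativeOnUniv.leibniz hY hg]
        simp
        ring
      add := fun {Y Z} hY hZ => by
        have e : (fun z => mvfderiv 𝓘(ℝ, E) f z ((Y + Z) z)) =
            (fun z => mvfderiv 𝓘(ℝ, E) f z (Y z)) + fun z => mvfderiv 𝓘(ℝ, E) f z (Z z) := by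
          ext z; simp
        rw [e, mvfderiv_add (mdifferentiableAt_mvfderiv_apply hCo hf hyC hY)
          (mdifferentiableAt_mvfderiv_apply hCo hf hyC hZ),
          cov.isCovariantDerivativeOnUniv.add hY hZ]
        simp
        ring }
  refine ht.pointwise (FiberBundle.mdifferentiableAt_extend ..) hX ?_
  simp

/-- The Hessian in the coordinates of the chart at `x₀`. -/
lemma hessian_eq_hessianCoord (hCo : IsOpen C) (hf : ContMDiffOn 𝓘(ℝ, E) 𝓘(ℝ, ℝ) ∞ f C)
    (hy : y ∈ (chartAt E x₀).source) (hyC : y ∈ C) (u v : TangentSpace 𝓘(ℝ, E) y) :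
    hessian cov f y u v =
      hessianCoord cov f x₀ (chartAt E x₀ y) (coordAt x₀ y u) (coordAt x₀ y v) := by
  have hX := mdifferentiableAt_constField hy (coordAt x₀ y v)
  have h := hessian_eq (cov := cov) hCo hf hyC hX u
  rw [constField_coordAt hy] at h
  have hfy : MDifferentiableAt 𝓘(ℝ, E) 𝓘(ℝ, ℝ) f y :=
    (hf.contMDiffAt (hCo.mem_nhds hyC)).mdifferentiableAt (by simp)
  rw [h, hessianCoord_apply, mvfderiv_eq_fderiv hy hfy,
    mvfderiv_eq_fderiv hy (mdifferentiableAt_mvfderiv_apply hCo hf hyC hX),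
    (chartAt E x₀).left_inv hy, christoffel_apply, frameAt_coordAt hy]
  congr 1
  have hd := (contDiffAt_fderiv_comp_chart_symm hCo hf hy hyC).differentiableAt (by simp)
  have e : (fun z => mvfderiv 𝓘(ℝ, E) f z (constField x₀ (coordAt x₀ y v) z)) ∘
      (chartAt E x₀).symm =ᶠ[𝓝 (chartAt E x₀ y)]
      fun q => fderiv ℝ (f ∘ (chartAt E x₀).symm) q (coordAt x₀ y v) := by
    have hq := (chartAt E x₀).map_source hy
    have hc : Filter.Tendsto (chartAt E x₀).symm (𝓝 (chartAt E x₀ y)) (𝓝 y) := by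
      have := (chartAt E x₀).symm.continuousAt hq
      rwa [ContinuousAt, (chartAt E x₀).left_inv hy] at this
    filter_upwards [hc.eventually (mvfderiv_eventuallyEq hCo hf hy hyC
      (constField x₀ (coordAt x₀ y v))), (chartAt E x₀).open_target.mem_nhds hq] with q h1 h2
    rw [Function.comp_apply, h1, (chartAt E x₀).right_inv h2,
      coordAt_constField ((chartAt E x₀).map_target h2)]
  rw [e.fderiv_eq, (hd.hasFDerivAt.clm_apply (hasFDerivAt_const _ _)).fderiv]
  simp

/-- The coordinate expression `∂²f - Df ∘ Γ` is built from smooth maps; this allows the Hessian to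
be differentiated along curves. -/
lemma contDiffAt_hessianCoord [T2Space M]
    [CovariantDerivative.ContMDiffCovariantDerivative cov ∞]
    (hCo : IsOpen C) (hf : ContMDiffOn 𝓘(ℝ, E) 𝓘(ℝ, ℝ) ∞ f C)
    (hy : y ∈ (chartAt E x₀).source) (hyC : y ∈ C) :
    ContDiffAt ℝ ∞ (hessianCoord cov f x₀) (chartAt E x₀ y) := by
  have h1 := contDiffAt_fderiv_comp_chart_symm hCo hf hy hyC
  have h2 : ContDiffAt ℝ ∞ (fun q => christoffel cov x₀ ((chartAt E x₀).symm q))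
      (chartAt E x₀ y) := (contDiffOn_christoffel x₀).contDiffAt
    ((chartAt E x₀).open_target.mem_nhds ((chartAt E x₀).map_source hy))
  have h3 : ContDiffAt ℝ ∞ (fun q => ContinuousLinearMap.compL ℝ E E ℝ
      (fderiv ℝ (f ∘ (chartAt E x₀).symm) q)) (chartAt E x₀ y) :=
    contDiffAt_const.clm_apply h1
  exact (h1.fderiv_right le_rfl).sub (h3.clm_comp h2)

/-- The covariant derivative of the Hessian in the coordinates of the chart at the point. -/
lemma covDerivTwo_hessian [T2Space M] [CovariantDerivative.ContMDiffCovariantDerivative cov ∞]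
    (hCo : IsOpen C) (hf : ContMDiffOn 𝓘(ℝ, E) 𝓘(ℝ, ℝ) ∞ f C) (hyC : y ∈ C)
    (u v w : TangentSpace 𝓘(ℝ, E) y) :
    covDerivTwo cov (hessian cov f) y u v w =
      fderiv ℝ (hessianCoord cov f y) (chartAt E y y) (coordAt y y u) (coordAt y y v)
          (coordAt y y w) -
        hessianCoord cov f y (chartAt E y y)
          (christoffel cov y y (coordAt y y u) (coordAt y y v)) (coordAt y y w) -
        hessianCoord cov f y (chartAt E y y) (coordAt y y v)
          (christoffel cov y y (coordAt y y u) (coordAt y y w)) := by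
  have hy := mem_chart_source E y
  have hB := (contDiffAt_hessianCoord (cov := cov) hCo hf hy hyC).differentiableAt (by simp)
  -- In the chart at `y` both extensions have constant coordinates, so only the coefficients of the
  -- Hessian vary with `z`.
  have e : (fun z => hessian cov f z (FiberBundle.extend E v z) (FiberBundle.extend E w z))
      =ᶠ[𝓝 y] fun z => hessianCoord cov f y (chartAt E y z) (coordAt y y v) (coordAt y y w) := by
    filter_upwards [eventually_mem_chart_source hy, hCo.mem_nhds hyC] with z hz hzC
    rw [hessian_eq_hessianCoord hCo hf hz hzC, extend_eq_constField, extend_eq_constField,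
      coordAt_constField hz, coordAt_constField hz]
  have hd := ((hB.hasFDerivAt.clm_apply (hasFDerivAt_const (coordAt y y v) _)).clm_apply
    (hasFDerivAt_const (coordAt y y w) _))
  have hφ : MDifferentiableAt 𝓘(ℝ, E) 𝓘(ℝ, E) (chartAt E y) y :=
    mdifferentiableAt_extChartAt (I := 𝓘(ℝ, E)) hy
  have hm : MDifferentiableAt 𝓘(ℝ, E) 𝓘(ℝ, ℝ) (fun z =>
      hessian cov f z (FiberBundle.extend E v z) (FiberBundle.extend E w z)) y :=
    e.mdifferentiableAt_iff.2
      (MDifferentiableAt.comp (I' := 𝓘(ℝ, E)) y hd.differentiableAt.mdifferentiableAt hφ)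
  have e2 : (fun z => hessian cov f z (FiberBundle.extend E v z) (FiberBundle.extend E w z)) ∘
      (chartAt E y).symm =ᶠ[𝓝 (chartAt E y y)]
      fun q => hessianCoord cov f y q (coordAt y y v) (coordAt y y w) := by
    have hq := (chartAt E y).map_source hy
    have hc : Filter.Tendsto (chartAt E y).symm (𝓝 (chartAt E y y)) (𝓝 y) := by
      have := (chartAt E y).symm.continuousAt hq
      rwa [ContinuousAt, (chartAt E y).left_inv hy] at this
    filter_upwards [hc.eventually e, (chartAt E y).open_target.mem_nhds hq] with q h1 h2
    rw [Function.comp_apply, h1, (chartAt E y).right_inv h2]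
  rw [covDerivTwo, mvfderiv_eq_fderiv hy hm, e2.fderiv_eq, hd.fderiv,
    hessian_eq_hessianCoord hCo hf hy hyC, hessian_eq_hessianCoord hCo hf hy hyC,
    christoffel_apply, christoffel_apply, frameAt_coordAt hy, extend_eq_constField,
    extend_eq_constField]
  simp

end Hessian

/-! ### Fields along curves and the chart form of the parallel transport equation. -/

section Curves

variable {γ : ℝ → M} {J : Set ℝ} {t : ℝ}

omit [IsManifold 𝓘(ℝ, E) ∞ M] in
lemma hasDerivWithinAt_comp {F : Type*} [NormedAddCommGroup F] [NormedSpace ℝ F] {g : M → F}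
    (hγ : MDifferentiableWithinAt 𝓘(ℝ, ℝ) 𝓘(ℝ, E) γ J t)
    (hg : MDifferentiableAt 𝓘(ℝ, E) 𝓘(ℝ, F) g (γ t)) :
    HasDerivWithinAt (g ∘ γ) (mvfderiv 𝓘(ℝ, E) g (γ t) (velocity γ J t)) J t := by
  have h : HasFDerivWithinAt (g ∘ γ)
      ((mvfderiv 𝓘(ℝ, E) g (γ t) ∘L mfderivWithin 𝓘(ℝ, ℝ) 𝓘(ℝ, E) γ J t : ℝ →L[ℝ] F)) J t :=
    hasMFDerivWithinAt_iff_hasFDerivWithinAt.1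
      (hg.hasMFDerivAt.comp_hasMFDerivWithinAt t hγ.hasMFDerivWithinAt)
  exact h.hasDerivWithinAt

lemma hasDerivWithinAt_chart_comp {x₀ : M}
    (hγ : MDifferentiableWithinAt 𝓘(ℝ, ℝ) 𝓘(ℝ, E) γ J t)
    (ht : γ t ∈ (chartAt E x₀).source) :
    HasDerivWithinAt (chartAt E x₀ ∘ γ) (coordAt x₀ (γ t) (velocity γ J t)) J t := by
  have h := hasDerivWithinAt_comp hγ (g := chartAt E x₀)
    (mdifferentiableAt_extChartAt (I := 𝓘(ℝ, E)) ht)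
  convert! h using 1
  rw [coordAt, TangentBundle.continuousLinearMapAt_trivializationAt ht]
  rfl

omit [NormedSpace ℝ E] [IsManifold 𝓘(ℝ, E) ∞ M] in
lemma eventually_mem_source {x₀ : M} (hγ : ContinuousWithinAt γ J t)
    (ht : γ t ∈ (chartAt E x₀).source) :
    ∀ᶠ r in 𝓝[J] t, γ r ∈ (chartAt E x₀).source :=
  hγ (eventually_mem_chart_source ht)

/-- The coordinate change from the chart at `x₀` to the chart at `x₁`, on tangent vectors. -/
lemma mdifferentiableAt_coordAt_comp_frameAt {x₀ x₁ y : M} (h₀ : y ∈ (chartAt E x₀).source)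
    (h₁ : y ∈ (chartAt E x₁).source) :
    MDifferentiableAt 𝓘(ℝ, E) 𝓘(ℝ, E →L[ℝ] E) (fun z => coordAt (E := E) x₁ z ∘L frameAt (E := E) x₀ z) y := by
  refine (mdifferentiableAt_coordChangeL (IB := 𝓘(ℝ, E))
    (e := trivializationAt E (TangentSpace 𝓘(ℝ, E) : M → Type _) x₀)
    (e' := trivializationAt E (TangentSpace 𝓘(ℝ, E) : M → Type _) x₁)
    h₀ h₁).congr_of_eventuallyEq ?_
  filter_upwards [eventually_mem_chart_source h₀, eventually_mem_chart_source h₁] with z hz₀ hz₁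
  ext w
  rw [ContinuousLinearMap.comp_apply, frameAt_apply hz₀, coordAt_apply hz₁]
  exact (Bundle.Trivialization.coordChangeL_apply _ _ ⟨hz₀, hz₁⟩ w).symm

lemma contDiffWithinAt_coordAt {x₀ : M} {V : ∀ t, TangentSpace 𝓘(ℝ, E) (γ t)}
    (hV : ContMDiffWithinAt 𝓘(ℝ, ℝ) 𝓘(ℝ, E).tangent ∞
      (fun t => (⟨γ t, V t⟩ : TangentBundle 𝓘(ℝ, E) M)) J t)
    (ht : γ t ∈ (chartAt E x₀).source) :
    ContDiffWithinAt ℝ ∞ (fun r => coordAt x₀ (γ r) (V r)) J t := by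
  have hvb := contMDiffVectorBundle_tangentSpace (E := E) (M := M)
  obtain ⟨h1, h2⟩ := (Bundle.Trivialization.contMDiffWithinAt_iff
    (e := trivializationAt E (TangentSpace 𝓘(ℝ, E) : M → Type _) x₀)
    (f := fun t => (⟨γ t, V t⟩ : TangentBundle 𝓘(ℝ, E) M)) (x₀ := t)
    ((Bundle.Trivialization.mem_source _).2 ht)).1 hV
  refine (contMDiffWithinAt_iff_contDiffWithinAt.1 h2).congr_of_eventuallyEq ?_
    (coordAt_apply ht _)
  filter_upwards [eventually_mem_source h1.continuousWithinAt ht] with r hr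
  exact coordAt_apply hr _

lemma contMDiffWithinAt_of_coordAt {x₀ : M} {V : ∀ t, TangentSpace 𝓘(ℝ, E) (γ t)}
    (hγ : ContMDiffWithinAt 𝓘(ℝ, ℝ) 𝓘(ℝ, E) ∞ γ J t)
    (ht : γ t ∈ (chartAt E x₀).source)
    (hV : ContDiffWithinAt ℝ ∞ (fun r => coordAt x₀ (γ r) (V r)) J t) :
    ContMDiffWithinAt 𝓘(ℝ, ℝ) 𝓘(ℝ, E).tangent ∞
      (fun t => (⟨γ t, V t⟩ : TangentBundle 𝓘(ℝ, E) M)) J t := by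
  have hvb := contMDiffVectorBundle_tangentSpace (E := E) (M := M)
  refine (Bundle.Trivialization.contMDiffWithinAt_iff
    (e := trivializationAt E (TangentSpace 𝓘(ℝ, E) : M → Type _) x₀)
    (f := fun t => (⟨γ t, V t⟩ : TangentBundle 𝓘(ℝ, E) M)) (x₀ := t)
    ((Bundle.Trivialization.mem_source _).2 ht)).2 ⟨hγ, ?_⟩
  refine (contMDiffWithinAt_iff_contDiffWithinAt.2 hV).congr_of_eventuallyEq ?_
    (coordAt_apply ht _).symm
  filter_upwards [eventually_mem_source hγ.continuousWithinAt ht] with r hr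
  exact (coordAt_apply hr _).symm

lemma contDiffWithinAt_chart_comp {x₀ : M}
    (hγ : ContMDiffWithinAt 𝓘(ℝ, ℝ) 𝓘(ℝ, E) ∞ γ J t)
    (ht : γ t ∈ (chartAt E x₀).source) :
    ContDiffWithinAt ℝ ∞ (chartAt E x₀ ∘ γ) J t :=
  contMDiffWithinAt_iff_contDiffWithinAt.1 ((contMDiffOn_chart.contMDiffAt
    (eventually_mem_chart_source ht)).comp_contMDiffWithinAt t hγ)

variable [FiniteDimensional ℝ E] (cov : AffineConnection E M)

/-- The matrix of the equation `v' = A v` for the coordinates, in the chart at `x₀`, of a parallel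
vector field along `γ : J → M`. -/
def transportMatrix (γ : ℝ → M) (J : Set ℝ) (x₀ : M) (t : ℝ) : E →L[ℝ] E :=
  -christoffel cov x₀ (γ t) (coordAt x₀ (γ t) (velocity γ J t))

/-- The coordinates of `V` in any chart around `γ t` satisfy the equation of parallel transport at
`t`, where the derivative is taken within `s`. -/
def IsParallelWithinAt (γ : ℝ → M) (J : Set ℝ) (V : ∀ t, TangentSpace 𝓘(ℝ, E) (γ t))
    (s : Set ℝ) (t : ℝ) : Prop :=
  ∀ x₀ : M, γ t ∈ (chartAt E x₀).source →
    HasDerivWithinAt (fun r => coordAt x₀ (γ r) (V r))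
      (transportMatrix cov γ J x₀ t (coordAt x₀ (γ t) (V t))) s t

variable {cov} {s : Set ℝ} {V : ∀ t, TangentSpace 𝓘(ℝ, E) (γ t)}

/-- The matrix is `Γ` along the curve, contracted with the velocity. Its continuity feeds the
existence theorem, its smoothness the bootstrap for solutions. -/
lemma contDiffWithinAt_transportMatrix [T2Space M]
    [CovariantDerivative.ContMDiffCovariantDerivative cov ∞] {x₀ : M}
    (hγ : ContMDiffWithinAt 𝓘(ℝ, ℝ) 𝓘(ℝ, E) ∞ γ J t)
    (hγ' : ContMDiffWithinAt 𝓘(ℝ, ℝ) 𝓘(ℝ, E).tangent ∞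
      (fun t => (⟨γ t, velocity γ J t⟩ : TangentBundle 𝓘(ℝ, E) M)) J t)
    (ht : γ t ∈ (chartAt E x₀).source) :
    ContDiffWithinAt ℝ ∞ (transportMatrix cov γ J x₀) J t := by
  have h1 := (((contDiffOn_christoffel (cov := cov) x₀).contDiffAt
    ((chartAt E x₀).open_target.mem_nhds ((chartAt E x₀).map_source ht))).comp_contDiffWithinAt t
    (contDiffWithinAt_chart_comp hγ ht))
  refine ((h1.clm_apply (contDiffWithinAt_coordAt hγ' ht)).neg).congr_of_eventuallyEq ?_ ?_
  · filter_upwards [eventually_mem_source hγ.continuousWithinAt ht] with r hr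
    simp [transportMatrix, (chartAt E x₀).left_inv hr]
  · simp [transportMatrix, (chartAt E x₀).left_inv ht]

/-- The equation of parallel transport does not depend on the chart. -/
lemma isParallelWithinAt_of_chart {x₀ : M} (hs : s ⊆ J)
    (hγ : MDifferentiableWithinAt 𝓘(ℝ, ℝ) 𝓘(ℝ, E) γ J t)
    (h₀ : γ t ∈ (chartAt E x₀).source)
    (h : HasDerivWithinAt (fun r => coordAt x₀ (γ r) (V r))
      (transportMatrix cov γ J x₀ t (coordAt x₀ (γ t) (V t))) s t) :
    IsParallelWithinAt cov γ J V s t := by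
  intro x₁ h₁
  have hT := mdifferentiableAt_coordAt_comp_frameAt h₀ h₁
  set T : M → E →L[ℝ] E := fun z => coordAt (E := E) x₁ z ∘L frameAt (E := E) x₀ z with hTdef
  have hTγ := (hasDerivWithinAt_comp hγ hT).mono hs
  set w := coordAt x₀ (γ t) (V t) with hw
  have hd := hTγ.clm_apply h
  have hev : ∀ r, γ r ∈ (chartAt E x₀).source → coordAt x₁ (γ r) (V r) =
      (T ∘ γ) r (coordAt x₀ (γ r) (V r)) := fun r hr => by
    simp [hTdef, frameAt_coordAt hr]
  refine (hd.congr_of_eventuallyEq ?_ (hev t h₀)).congr_deriv ?_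
  · filter_upwards [(eventually_mem_source hγ.continuousWithinAt h₀).filter_mono
      (nhdsWithin_mono _ hs)] with r hr
    exact hev r hr
  · have hX := mdifferentiableAt_constField h₀ w
    have e : (fun z => coordAt x₁ z (constField x₀ w z)) =ᶠ[𝓝 (γ t)] fun z => T z w := by
      filter_upwards [eventually_mem_chart_source h₀] with z hz
      simp [hTdef, frameAt_apply hz]
    have hTw := ((ContinuousLinearMap.apply ℝ E w).hasMFDerivAt.comp (γ t) hT.hasMFDerivAt)
    have hm : mvfderiv 𝓘(ℝ, E) (fun z => coordAt x₁ z (constField x₀ w z)) (γ t)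
        (velocity γ J t) = mvfderiv 𝓘(ℝ, E) T (γ t) (velocity γ J t) w := by
      rw [mvfderiv, (hTw.congr_of_eventuallyEq e).mfderiv]
      rfl
    -- This is the transformation law of the Christoffel symbols, found by computing `∇` of a
    -- constant field of the chart at `x₀` in the chart at `x₁`. It accounts for the derivative of
    -- the coordinate change `T` in the product rule.
    have hc := coordAt_cov (cov := cov) h₁ hX (velocity γ J t)
    have hc0 : frameAt x₀ (γ t) (christoffel cov x₀ (γ t)
        (coordAt x₀ (γ t) (velocity γ J t)) w) =
        cov (constField x₀ w) (γ t) (velocity γ J t) := by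
      rw [christoffel_apply, frameAt_coordAt h₀, frameAt_coordAt h₀]
    rw [hm, constField_coordAt h₀] at hc
    simp only [transportMatrix, neg_apply, map_neg, Function.comp_apply]
    rw [hTdef]
    simp only [ContinuousLinearMap.comp_apply]
    rw [hc0, hc]
    abel

end Curves

/-! ### Existence of parallel transport along geodesics. -/

/-- A linear ordinary differential equation has solutions on short intervals. -/
lemma exists_hasDerivWithinAt_linear {F : Type*} [NormedAddCommGroup F] [NormedSpace ℝ F]
    [CompleteSpace F] {A : ℝ → F →L[ℝ] F} {a b : ℝ} (hab : a ≤ b)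
    (hA : ContinuousOn A (Icc a b)) {K : NNReal} (hK : ∀ t ∈ Icc a b, ‖A t‖ ≤ K)
    (hs : K * (b - a) ≤ 1 / 2) (x : F) :
    ∃ α : ℝ → F, α a = x ∧ ∀ t ∈ Icc a b, HasDerivWithinAt α (A t (α t)) (Icc a b) t := by
  -- On the ball of radius `‖x‖` about `x` the speed is at most `2K‖x‖`, so a solution stays in it
  -- for time `1 / (2K)`. By linearity this time does not depend on `x`.
  have h : IsPicardLindelof (fun t y => A t y) (⟨a, left_mem_Icc.2 hab⟩ : Icc a b) x
      ‖x‖₊ 0 (K * (2 * ‖x‖₊)) K :=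
    { lipschitzOnWith := fun t ht =>
        ((A t).lipschitz.weaken (hK t ht)).lipschitzOnWith
      continuousOn := fun y _ => hA.clm_apply continuousOn_const
      norm_le := fun t ht y hy => by
        have h1 : ‖y‖ ≤ 2 * ‖x‖ := by
          have h2 : ‖y - x‖ ≤ ‖x‖ := by simpa [dist_eq_norm] using hy
          have h3 := norm_add_le (y - x) x
          rw [sub_add_cancel] at h3
          linarith
        push_cast
        exact ((A t).le_opNorm y).trans
          (mul_le_mul (hK t ht) h1 (norm_nonneg _) K.coe_nonneg)
      mul_max_le := by
        have hx := norm_nonneg x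
        have : max (b - a) (a - a) = b - a := max_eq_left (by linarith)
        push_cast
        rw [this]
        nlinarith }
  exact h.exists_eq_forall_mem_Icc_hasDerivWithinAt₀

section Transport

variable [FiniteDimensional ℝ E] {cov : AffineConnection E M}
  {γ : ℝ → M} {a b t : ℝ}

lemma IsParallelWithinAt.congr {J s : Set ℝ} {V W : ∀ t, TangentSpace 𝓘(ℝ, E) (γ t)}
    (h : IsParallelWithinAt cov γ J V s t) (hs : ∀ r ∈ s, W r = V r) (ht : W t = V t) :
    IsParallelWithinAt cov γ J W s t := by
  intro x₀ hx₀
  rw [ht]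
  exact (h x₀ hx₀).congr (fun r hr => by rw [hs r hr]) (by rw [ht])

lemma IsParallelWithinAt.union {J s s' : Set ℝ} {V : ∀ t, TangentSpace 𝓘(ℝ, E) (γ t)}
    (h : IsParallelWithinAt cov γ J V s t) (h' : IsParallelWithinAt cov γ J V s' t) :
    IsParallelWithinAt cov γ J V (s ∪ s') t :=
  fun x₀ hx₀ => (h x₀ hx₀).union (h' x₀ hx₀)

/-- Used in gluing: at a time belonging to only one of the two intervals, the condition on the other
is vacuous. -/
lemma isParallelWithinAt_of_notMem_closure {J s : Set ℝ} {V : ∀ t, TangentSpace 𝓘(ℝ, E) (γ t)}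
    (ht : t ∉ closure s) : IsParallelWithinAt cov γ J V s t := by
  intro x₀ _
  rw [hasDerivWithinAt_iff_hasFDerivWithinAt]
  exact HasFDerivWithinAt.of_notMem_closure ht

/-- Parallel vector fields on adjacent intervals can be glued. -/
lemma exists_isParallelWithinAt_glue {J : Set ℝ} {a b c : ℝ} (hab : a ≤ b) (hbc : b ≤ c)
    {V W : ∀ t, TangentSpace 𝓘(ℝ, E) (γ t)}
    (hV : ∀ t ∈ Icc a b, IsParallelWithinAt cov γ J V (Icc a b) t)
    (hW : ∀ t ∈ Icc b c, IsParallelWithinAt cov γ J W (Icc b c) t) (h : V b = W b) :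
    ∃ U : ∀ t, TangentSpace 𝓘(ℝ, E) (γ t), U a = V a ∧
      ∀ t ∈ Icc a c, IsParallelWithinAt cov γ J U (Icc a c) t := by
  classical
  set U : ∀ t, TangentSpace 𝓘(ℝ, E) (γ t) := fun t => if t ≤ b then V t else W t with hU
  have hUV : ∀ r ∈ Icc a b, U r = V r := fun r hr => if_pos hr.2
  have hUW : ∀ r ∈ Icc b c, U r = W r := fun r hr => by
    rcases hr.1.eq_or_lt with rfl | h'
    · rw [← h]; exact if_pos le_rfl
    · exact if_neg (not_le.2 h')
  refine ⟨U, hUV a (left_mem_Icc.2 hab), fun t ht => ?_⟩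
  rw [← Icc_union_Icc_eq_Icc hab hbc]
  refine IsParallelWithinAt.union ?_ ?_
  · by_cases htb : t ∈ Icc a b
    · exact (hV t htb).congr hUV (hUV t htb)
    · exact isParallelWithinAt_of_notMem_closure (by rwa [isClosed_Icc.closure_eq])
  · by_cases htb : t ∈ Icc b c
    · exact (hW t htb).congr hUW (hUW t htb)
    · exact isParallelWithinAt_of_notMem_closure (by rwa [isClosed_Icc.closure_eq])

/-- Parallel vector fields satisfy the equation of parallel transport. -/
lemma IsParallelAlong.hasDerivWithinAt_coordAt
    (hγ : ContMDiffOn 𝓘(ℝ, ℝ) 𝓘(ℝ, E) ∞ γ (Icc a b))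
    {V : ∀ t, TangentSpace 𝓘(ℝ, E) (γ t)}
    (hV : IsParallelAlong cov γ (Icc a b) V) (ht : t ∈ Icc a b) :
    HasDerivWithinAt (fun r => coordAt (γ t) (γ r) (V r))
      (-christoffel cov (γ t) (γ t) (coordAt (γ t) (γ t) (velocity γ (Icc a b) t))
        (coordAt (γ t) (γ t) (V t))) (Icc a b) t := by
  have hx₀ : γ t ∈ (chartAt E (γ t)).source := mem_chart_source E (γ t)
  have hd := ((contDiffWithinAt_coordAt (hV.1 t ht) hx₀).differentiableWithinAt
    (by simp)).hasDerivWithinAt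
  have e : derivWithin (fun r => (trivializationAt E (TangentSpace 𝓘(ℝ, E) : M → Type _) (γ t)
      (⟨γ r, V r⟩ : TangentBundle 𝓘(ℝ, E) M)).2) (Icc a b) t =
      derivWithin (fun r => coordAt (γ t) (γ r) (V r)) (Icc a b) t := by
    refine Filter.EventuallyEq.derivWithin_eq ?_ (coordAt_apply hx₀ _).symm
    filter_upwards [eventually_mem_source (hγ t ht).continuousWithinAt hx₀] with r hr
    exact (coordAt_apply hr _).symm
  refine hd.congr_deriv ?_
  have h := congrArg (coordAt (γ t) (γ t)) (hV.2 t ht)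
  have e' := coordAt_constField hx₀
    (derivWithin (fun r => coordAt (γ t) (γ r) (V r)) (Icc a b) t)
  rw [constField] at e'
  rw [covDerivAlong, e, map_add, map_zero, e', extend_eq_constField] at h
  rw [christoffel_apply, frameAt_coordAt hx₀]
  exact eq_neg_of_add_eq_zero_left h

variable [T2Space M] [CovariantDerivative.ContMDiffCovariantDerivative cov ∞]

/-- The existence time of a linear equation depends only on a bound for its matrix. Hence one
neighbourhood `U` serves all initial vectors and all initial times, which makes finite gluing
possible. -/
lemma exists_isParallelWithinAt_local (hγ : IsGeodesic cov γ a b) {t₀ : ℝ} (ht₀ : t₀ ∈ Icc a b) :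
    ∃ U : Set ℝ, IsOpen U ∧ t₀ ∈ U ∧ ∀ c d, c ≤ d → Icc c d ⊆ U → Icc c d ⊆ Icc a b →
      ∀ u : TangentSpace 𝓘(ℝ, E) (γ c), ∃ V : ∀ t, TangentSpace 𝓘(ℝ, E) (γ t), V c = u ∧
        ∀ t ∈ Icc c d, IsParallelWithinAt cov γ (Icc a b) V (Icc c d) t := by
  set J := Icc a b
  set x₀ := γ t₀
  set A := transportMatrix cov γ J x₀ with hA
  have hx₀ : γ t₀ ∈ (chartAt E x₀).source := mem_chart_source E x₀
  have hAc : ∀ t ∈ J, γ t ∈ (chartAt E x₀).source → ContinuousWithinAt A J t := fun t ht h =>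
    (contDiffWithinAt_transportMatrix (hγ.1 t ht) (hγ.2.1 t ht) h).continuousWithinAt
  set K : NNReal := ‖A t₀‖₊ + 1 with hK
  have hev : ∀ᶠ r in 𝓝[J] t₀, γ r ∈ (chartAt E x₀).source ∧ ‖A r‖ < K := by
    refine (eventually_mem_source (hγ.1 t₀ ht₀).continuousWithinAt hx₀).and ?_
    exact (hAc t₀ ht₀ hx₀).norm.eventually_lt_const (by simp [hK])
  obtain ⟨δ, hδ, hball⟩ := Metric.mem_nhdsWithin_iff.1 hev
  have hKpos : (0 : ℝ) < K := by positivity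
  -- An interval inside the ball has length at most `2ε ≤ 1 / (2K)`, the time allowed by the linear
  -- existence lemma.
  set ε := min δ (1 / (4 * K)) with hε
  have hεpos : 0 < ε := lt_min hδ (by positivity)
  refine ⟨Metric.ball t₀ ε, Metric.isOpen_ball, Metric.mem_ball_self hεpos,
    fun c d hcd hU hJ u => ?_⟩
  have hmem : ∀ r ∈ Icc c d, γ r ∈ (chartAt E x₀).source ∧ ‖A r‖ < K := fun r hr =>
    hball ⟨Metric.ball_subset_ball (min_le_left _ _) (hU hr), hJ hr⟩
  have hlen : K * (d - c) ≤ 1 / 2 := by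
    have h1 := hU (left_mem_Icc.2 hcd)
    have h2 := hU (right_mem_Icc.2 hcd)
    rw [Metric.mem_ball, Real.dist_eq, abs_lt] at h1 h2
    have h3 : ε ≤ 1 / (4 * K) := min_le_right _ _
    have h4 : d - c ≤ 1 / (2 * K) := by
      have : (1 : ℝ) / (2 * K) = 2 * (1 / (4 * K)) := by field_simp; norm_num
      linarith
    calc (K : ℝ) * (d - c) ≤ K * (1 / (2 * K)) := by gcongr
      _ = 1 / 2 := by field_simp
  obtain ⟨v, hvc, hv⟩ := exists_hasDerivWithinAt_linear hcd (A := A)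
    (fun r hr => (hAc r (hJ hr) (hmem r hr).1).mono hJ) (fun r hr => (hmem r hr).2.le) hlen
    (coordAt x₀ (γ c) u)
  refine ⟨fun t => frameAt x₀ (γ t) (v t), ?_, fun t ht => ?_⟩
  · dsimp only
    rw [hvc, frameAt_coordAt (hmem c (left_mem_Icc.2 hcd)).1]
  · refine isParallelWithinAt_of_chart hJ ((hγ.1 t (hJ ht)).mdifferentiableWithinAt (by simp))
      (hmem t ht).1 ?_
    rw [coordAt_frameAt (hmem t ht).1]
    exact (hv t ht).congr (fun r hr => coordAt_frameAt (hmem r hr).1 _)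
      (coordAt_frameAt (hmem t ht).1 _)

/-- By compactness a finite partition of `[a, b]` has each piece inside one of the local
neighbourhoods; solutions are extended piece by piece, each starting at the end value of the
previous one. -/
lemma exists_isParallelWithinAt (hab : a ≤ b) (hγ : IsGeodesic cov γ a b)
    (u : TangentSpace 𝓘(ℝ, E) (γ a)) :
    ∃ V : ∀ t, TangentSpace 𝓘(ℝ, E) (γ t), V a = u ∧
      ∀ t ∈ Icc a b, IsParallelWithinAt cov γ (Icc a b) V (Icc a b) t := by
  choose! U hUo hUt hU using fun t₀ (ht₀ : t₀ ∈ Icc a b) => exists_isParallelWithinAt_local hγ ht₀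
  obtain ⟨p, hp0, hpm, ⟨m, hm⟩, hp⟩ := exists_monotone_Icc_subset_open_cover_Icc hab
    (c := fun i : Icc a b => (Subtype.val ⁻¹' U i : Set (Icc a b)))
    (fun i => (hUo i i.2).preimage continuous_subtype_val)
    (fun i _ => mem_iUnion.2 ⟨i, hUt i i.2⟩)
  have key : ∀ n, ∃ V : ∀ t, TangentSpace 𝓘(ℝ, E) (γ t), V a = u ∧
      ∀ t ∈ Icc a (p n : ℝ), IsParallelWithinAt cov γ (Icc a b) V (Icc a (p n)) t := by
    have ha : a ∈ Icc a b := left_mem_Icc.2 hab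
    intro n
    induction n with
    | zero =>
      obtain ⟨V, hV, hV'⟩ := hU a ha a a le_rfl
        (by simpa using hUt a ha) (by simpa using hab) u
      rw [hp0]
      exact ⟨V, hV, hV'⟩
    | succ n ih =>
      obtain ⟨V, hV, hV'⟩ := ih
      obtain ⟨i, hi⟩ := hp n
      have hle : (p n : ℝ) ≤ p (n + 1) := hpm n.le_succ
      have hsub : Icc (p n : ℝ) (p (n + 1)) ⊆ Icc a b := Icc_subset_Icc (p n).2.1 (p (n + 1)).2.2
      obtain ⟨W, hW, hW'⟩ := hU i i.2 (p n) (p (n + 1)) hle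
        (fun r hr => hi (show (⟨r, hsub hr⟩ : Icc a b) ∈ Icc (p n) (p (n + 1)) from hr))
        hsub (V (p n))
      obtain ⟨Z, hZ, hZ'⟩ := exists_isParallelWithinAt_glue (p n).2.1 hle hV' hW' hW.symm
      exact ⟨Z, hZ.trans hV, hZ'⟩
  have := key m
  rwa [hm m le_rfl] at this

/-- Solutions of the equation of parallel transport are smooth. -/
lemma isParallelAlong_of_isParallelWithinAt (hab : a < b) (hγ : IsGeodesic cov γ a b)
    {V : ∀ t, TangentSpace 𝓘(ℝ, E) (γ t)}
    (hV : ∀ t ∈ Icc a b, IsParallelWithinAt cov γ (Icc a b) V (Icc a b) t) :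
    IsParallelAlong cov γ (Icc a b) V := by
  refine ⟨fun t ht => ?_, fun t ht => ?_⟩
  · set x₀ := γ t
    have hx₀ : γ t ∈ (chartAt E x₀).source := mem_chart_source E x₀
    refine contMDiffWithinAt_of_coordAt (x₀ := x₀) (hγ.1 t ht) hx₀ ?_
    set v := fun r => coordAt x₀ (γ r) (V r)
    obtain ⟨δ, hδ, hball⟩ := Metric.mem_nhdsWithin_iff.1
      (eventually_mem_source (hγ.1 t ht).continuousWithinAt hx₀)
    set s := Icc a b ∩ Metric.ball t δ
    have hs : ∀ r ∈ s, γ r ∈ (chartAt E x₀).source := fun r hr => hball ⟨hr.2, hr.1⟩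
    have hsJ : s ⊆ Icc a b := inter_subset_left
    have hu : UniqueDiffOn ℝ s := (uniqueDiffOn_Icc hab).inter Metric.isOpen_ball
    have hA : ContDiffOn ℝ ∞ (transportMatrix cov γ (Icc a b) x₀) s := fun r hr =>
      (contDiffWithinAt_transportMatrix (hγ.1 r hr.1) (hγ.2.1 r hr.1) (hs r hr)).mono hsJ
    have hv : ∀ r ∈ s, HasDerivWithinAt v (transportMatrix cov γ (Icc a b) x₀ r (v r)) s r :=
      fun r hr => (hV r hr.1 x₀ (hs r hr)).mono hsJ
    -- Bootstrap: in `v' = A v` with `A` smooth, a `C^n` solution has a `C^n` derivative, so it is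
    -- `C^{n+1}`.
    have hn : ∀ n : ℕ, ContDiffOn ℝ n v s := by
      intro n
      induction n with
      | zero => exact contDiffOn_zero.2 fun r hr => (hv r hr).continuousWithinAt
      | succ n ih =>
        push_cast
        rw [contDiffOn_succ_iff_derivWithin hu]
        refine ⟨fun r hr => (hv r hr).differentiableWithinAt, by simp, ?_⟩
        exact ((hA.of_le (by exact_mod_cast le_top)).clm_apply ih).congr
          fun r hr => (hv r hr).derivWithin (hu r hr)
    exact (contDiffOn_infty.2 hn t ⟨ht, Metric.mem_ball_self hδ⟩).mono_of_mem_nhdsWithin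
      (Filter.inter_mem self_mem_nhdsWithin
        (mem_nhdsWithin_of_mem_nhds (Metric.ball_mem_nhds t hδ)))
  · have hx₀ : γ t ∈ (chartAt E (γ t)).source := mem_chart_source E (γ t)
    have h := hV t ht (γ t) hx₀
    have h' : HasDerivWithinAt (fun r =>
        (trivializationAt E (TangentSpace 𝓘(ℝ, E) : M → Type _) (γ t)
          (⟨γ r, V r⟩ : TangentBundle 𝓘(ℝ, E) M)).2)
        (transportMatrix cov γ (Icc a b) (γ t) t (coordAt (γ t) (γ t) (V t))) (Icc a b) t := by
      refine h.congr_of_eventuallyEq ?_ (coordAt_apply hx₀ _).symm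
      filter_upwards [eventually_mem_source (hγ.1 t ht).continuousWithinAt hx₀] with r hr
      exact (coordAt_apply hr _).symm
    rw [covDerivAlong, h'.derivWithin (uniqueDiffOn_Icc hab t ht)]
    apply coordAt_injective hx₀
    rw [map_add, map_zero]
    have e := coordAt_constField hx₀
      (transportMatrix cov γ (Icc a b) (γ t) t (coordAt (γ t) (γ t) (V t)))
    rw [constField] at e
    rw [e, extend_eq_constField, transportMatrix, neg_apply, christoffel_apply,
      frameAt_coordAt hx₀]
    simp

/-- Parallel transport along a geodesic exists. -/
lemma isParallelTransport_parallelTransport (hab : a < b) (hγ : IsGeodesic cov γ a b) :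
    IsParallelTransport cov γ a b (parallelTransport cov γ a b) := by
  have hex : ∃ τ, IsParallelTransport cov γ a b τ := by
    choose V hVa hV using fun u => exists_isParallelWithinAt hab.le hγ u
    have : FiniteDimensional ℝ (TangentSpace 𝓘(ℝ, E) (γ a)) :=
      inferInstanceAs (FiniteDimensional ℝ E)
    -- Linearity in the initial vector is obtained without uniqueness: solutions are chosen for a
    -- basis and extended linearly, and linear combinations of solutions are solutions.
    set B := Module.finBasis ℝ (TangentSpace 𝓘(ℝ, E) (γ a))
    refine ⟨fun t => B.constr ℝ fun i => V (B i) t, B.ext fun i => ?_, fun u =>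
      isParallelAlong_of_isParallelWithinAt hab hγ fun t ht x₀ hx₀ => ?_⟩
    · simp [hVa]
    · have h := HasDerivWithinAt.fun_sum (u := Finset.univ) fun i _ =>
        (hV (B i) t ht x₀ hx₀).const_smul (B.repr u i)
      simpa [Module.Basis.constr_apply_fintype] using h
  rw [parallelTransport, dif_pos hex]
  exact hex.choose_spec

end Transport

/-! ### Differentiating the Hessian along parallel fields. -/

section HessianAlong

variable [FiniteDimensional ℝ E] {cov : AffineConnection E M} [T2Space M]
  [CovariantDerivative.ContMDiffCovariantDerivative cov ∞]
  {C : Set M} {f : M → ℝ} {γ : ℝ → M} {a b t : ℝ}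

omit [T2Space M] [CovariantDerivative.ContMDiffCovariantDerivative cov ∞] in
lemma hessian_eventuallyEq (hCo : IsOpen C) (hf : ContMDiffOn 𝓘(ℝ, E) 𝓘(ℝ, ℝ) ∞ f C)
    {J : Set ℝ} (hγ : ContinuousWithinAt γ J t) (htC : γ t ∈ C)
    (V W : ∀ t, TangentSpace 𝓘(ℝ, E) (γ t)) :
    (fun r => hessian cov f (γ r) (V r) (W r)) =ᶠ[𝓝[J] t] fun r =>
      hessianCoord cov f (γ t) (chartAt E (γ t) (γ r)) (coordAt (γ t) (γ r) (V r))
        (coordAt (γ t) (γ r) (W r)) := by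
  filter_upwards [eventually_mem_source hγ (mem_chart_source E (γ t)), hγ (hCo.mem_nhds htC)]
    with r hr hrC
  exact hessian_eq_hessianCoord hCo hf hr hrC _ _

/-- Along parallel vector fields, the derivative of the Hessian is its covariant derivative. -/
lemma hasDerivWithinAt_hessian (hCo : IsOpen C) (hf : ContMDiffOn 𝓘(ℝ, E) 𝓘(ℝ, ℝ) ∞ f C)
    (hγ : ContMDiffOn 𝓘(ℝ, ℝ) 𝓘(ℝ, E) ∞ γ (Icc a b)) (ht : t ∈ Icc a b) (htC : γ t ∈ C)
    {V W : ∀ t, TangentSpace 𝓘(ℝ, E) (γ t)} (hV : IsParallelAlong cov γ (Icc a b) V)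
    (hW : IsParallelAlong cov γ (Icc a b) W) :
    HasDerivWithinAt (fun r => hessian cov f (γ r) (V r) (W r))
      (covDerivTwo cov (hessian cov f) (γ t) (velocity γ (Icc a b) t) (V t) (W t))
      (Icc a b) t := by
  have hx₀ := mem_chart_source E (γ t)
  have hc := hasDerivWithinAt_chart_comp ((hγ t ht).mdifferentiableWithinAt (by simp)) hx₀
  have hB := ((contDiffAt_hessianCoord (cov := cov) hCo hf hx₀ htC).differentiableAt
    (by simp)).hasFDerivAt.comp_hasDerivWithinAt t hc
  refine (((hB.clm_apply (hV.hasDerivWithinAt_coordAt hγ ht)).clm_apply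
    (hW.hasDerivWithinAt_coordAt hγ ht)).congr_of_eventuallyEq
      (hessian_eventuallyEq hCo hf (hγ t ht).continuousWithinAt htC V W)
      (hessian_eq_hessianCoord hCo hf hx₀ htC _ _)).congr_deriv ?_
  -- The derivatives of the two parallel fields contribute exactly the two Christoffel corrections
  -- in the covariant derivative.
  rw [covDerivTwo_hessian hCo hf htC]
  simp
  ring

end HessianAlong

/-! ### Differential inequalities -/

section Scalar

variable {g φ : ℝ → ℝ} {g' φ' : ℝ → ℝ}

lemma monotoneOn_Icc_of_hasDerivWithinAt_nonneg {a b : ℝ}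
    (hg : ∀ t ∈ Icc a b, HasDerivWithinAt g (g' t) (Icc a b) t)
    (h : ∀ t ∈ Icc a b, 0 ≤ g' t) : MonotoneOn g (Icc a b) :=
  monotoneOn_of_hasDerivWithinAt_nonneg (convex_Icc a b)
    (fun t ht => (hg t ht).continuousWithinAt)
    (fun t ht => (hg t (interior_subset ht)).mono interior_subset)
    (fun t ht => h t (interior_subset ht))

/-- A differential inequality of Bernstein type: `|g'| ≤ 2 c / (1 - c t) g`. -/
lemma bounds_of_abs_deriv_le {c : ℝ} (hc1 : c < 1)
    (hg : ∀ t ∈ Icc (0 : ℝ) 1, HasDerivWithinAt g (g' t) (Icc 0 1) t)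
    (h : ∀ t ∈ Icc (0 : ℝ) 1, |g' t| ≤ 2 * (c / (1 - c * t)) * g t) {t : ℝ}
    (ht : t ∈ Icc (0 : ℝ) 1) :
    (1 - c * t) ^ 2 * g 0 ≤ g t ∧ g t ≤ (1 / (1 - c * t) ^ 2) * g 0 := by
  have hpos : ∀ t ∈ Icc (0 : ℝ) 1, 0 < 1 - c * t := fun t ht => by
    rcases le_total c 0 with hc | hc
    · nlinarith [mul_nonneg (neg_nonneg.2 hc) ht.1]
    · nlinarith [mul_le_mul_of_nonneg_left ht.2 hc]
  have h0 : (0 : ℝ) ∈ Icc (0 : ℝ) 1 := ⟨le_rfl, zero_le_one⟩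
  have hl : ∀ t : ℝ, HasDerivWithinAt (fun t => 1 - c * t) (-c) (Icc 0 1) t := fun t => by
    simpa using ((hasDerivWithinAt_id t (Icc (0 : ℝ) 1)).const_mul c).const_sub 1
  have hb : ∀ t ∈ Icc (0 : ℝ) 1, |g' t| * (1 - c * t) ≤ 2 * c * g t := fun t ht => by
    have := mul_le_mul_of_nonneg_right (h t ht) (hpos t ht).le
    have e : 2 * (c / (1 - c * t)) * g t * (1 - c * t) = 2 * c * g t := by
      field_simp [(hpos t ht).ne']
    rwa [e] at this
  constructor
  -- The quotient `g / (1 - ct)^2` is nondecreasing.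
  · have hm := monotoneOn_Icc_of_hasDerivWithinAt_nonneg
      (fun t ht => (hg t ht).div ((hl t).pow 2) (pow_pos (hpos t ht) 2).ne') (fun t ht => by
        refine div_nonneg ?_ (by positivity)
        have h1 := hb t ht
        have h2 := neg_abs_le (g' t)
        have h3 := hpos t ht
        have h4 : 0 ≤ g' t * (1 - c * t) + 2 * c * g t := by
          nlinarith [mul_le_mul_of_nonneg_right h2 h3.le]
        have h5 := mul_nonneg h3.le h4
        simp only [Nat.cast_ofNat, Nat.add_one_sub_one, pow_one]
        simp only [Pi.pow_apply]
        nlinarith)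
    have := hm h0 ht ht.1
    simp only [Pi.div_apply, Pi.pow_apply] at this
    rw [le_div_iff₀ (pow_pos (hpos t ht) 2)] at this
    simpa [mul_comm] using this
  -- The product `g (1 - ct)^2` is nonincreasing; its negative is used.
  · have hm := monotoneOn_Icc_of_hasDerivWithinAt_nonneg
      (fun t ht => ((hg t ht).mul ((hl t).pow 2)).neg) (fun t ht => by
        have h1 := hb t ht
        have h2 := le_abs_self (g' t)
        have h3 := hpos t ht
        have h4 : g' t * (1 - c * t) - 2 * c * g t ≤ 0 := by
          nlinarith [mul_le_mul_of_nonneg_right h2 h3.le]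
        have h5 := mul_nonneg h3.le (neg_nonneg.2 h4)
        simp only [Nat.cast_ofNat, Nat.add_one_sub_one, pow_one]
        simp only [Pi.pow_apply]
        nlinarith)
    have := hm h0 ht ht.1
    simp only [Pi.neg_apply, Pi.mul_apply, Pi.pow_apply] at this
    rw [one_div_mul_eq_div, le_div_iff₀ (pow_pos (hpos t ht) 2)]
    simpa using this

/-- If `|φ'| ≤ 2 σ φ^{3/2}` then `φ^{1/2}` stays below the solution of the corresponding equation. -/
lemma sqrt_le_of_abs_deriv_le {σ : ℝ} (hσ : 0 ≤ σ)
    (hφ : ∀ t ∈ Icc (0 : ℝ) 1, HasDerivWithinAt φ (φ' t) (Icc 0 1) t)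
    (hφ0 : ∀ t ∈ Icc (0 : ℝ) 1, 0 ≤ φ t)
    (h : ∀ t ∈ Icc (0 : ℝ) 1, |φ' t| ≤ 2 * σ * √(φ t) * φ t)
    (hlt : σ * √(φ 0) < 1) {t : ℝ} (ht : t ∈ Icc (0 : ℝ) 1) :
    √(φ t) ≤ √(φ 0) / (1 - σ * √(φ 0) * t) := by
  have h0 : (0 : ℝ) ∈ Icc (0 : ℝ) 1 := ⟨le_rfl, zero_le_one⟩
  have hcont : ContinuousOn (fun t => √(φ t)) (Icc 0 1) :=
    ContinuousOn.sqrt fun t ht => (hφ t ht).continuousWithinAt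
  -- Dividing by `√φ` requires `φ > 0`. Boundedness gives the linear inequality `|φ'| ≤ Kφ`, and
  -- comparison with exponentials yields a dichotomy: `φ` vanishes identically if `φ 0 = 0`, and
  -- otherwise stays positive.
  obtain ⟨B, hB⟩ := isCompact_Icc.bddAbove_image hcont
  have hB' : ∀ t ∈ Icc (0 : ℝ) 1, √(φ t) ≤ B := fun t ht => hB (mem_image_of_mem _ ht)
  have hB0 : 0 ≤ B := (Real.sqrt_nonneg _).trans (hB' 0 h0)
  set K := 2 * σ * B with hK
  have hbK : ∀ t ∈ Icc (0 : ℝ) 1, |φ' t| ≤ K * φ t := fun t ht =>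
    (h t ht).trans (mul_le_mul_of_nonneg_right
      (mul_le_mul_of_nonneg_left (hB' t ht) (by positivity)) (hφ0 t ht))
  have hexp : ∀ k t : ℝ, HasDerivWithinAt (fun t => Real.exp (k * t)) (Real.exp (k * t) * k)
      (Icc 0 1) t := fun k t => by
    simpa using (((hasDerivAt_id t).const_mul k).exp).hasDerivWithinAt
  rcases (hφ0 0 h0).eq_or_lt with hz | hz
  · have hm := monotoneOn_Icc_of_hasDerivWithinAt_nonneg
      (fun t ht => ((hφ t ht).mul (hexp (-K) t)).neg) (fun t ht => by
        have h1 := (le_abs_self _).trans (hbK t ht)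
        have h2 := mul_nonneg (sub_nonneg.2 h1) (Real.exp_pos (-K * t)).le
        nlinarith)
    have h2 := hm h0 ht ht.1
    simp only [Pi.neg_apply, Pi.mul_apply] at h2
    rw [← hz] at h2
    have h3 : φ t ≤ 0 := by
      by_contra! h4
      have := mul_pos h4 (Real.exp_pos (-K * t))
      linarith
    rw [← hz, Real.sqrt_eq_zero_of_nonpos h3]
    simp
  · have hpos : ∀ t ∈ Icc (0 : ℝ) 1, 0 < φ t := fun t ht => by
      have hm := monotoneOn_Icc_of_hasDerivWithinAt_nonneg
        (fun t ht => (hφ t ht).mul (hexp K t)) (fun t ht => by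
          have h1 := (neg_le_neg (hbK t ht)).trans (neg_abs_le _)
          have h2 := mul_nonneg (sub_nonneg.2 h1) (Real.exp_pos (K * t)).le
          nlinarith)
      have h2 := hm h0 ht ht.1
      simp only [Pi.mul_apply, mul_zero, Real.exp_zero, mul_one] at h2
      exact (pos_iff_pos_of_mul_pos (hz.trans_le h2)).2 (Real.exp_pos _)
    have hsp : ∀ t ∈ Icc (0 : ℝ) 1, 0 < √(φ t) := fun t ht => Real.sqrt_pos.2 (hpos t ht)
    -- Here `(φ^{-1/2})' = -φ' / (2 φ^{3/2}) ≥ -σ`, so `φ^{-1/2} + σt` is nondecreasing.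
    have hm := monotoneOn_Icc_of_hasDerivWithinAt_nonneg
      (fun t ht => (((hφ t ht).sqrt (hpos t ht).ne').inv (hsp t ht).ne').add
        ((hasDerivWithinAt_id t (Icc (0 : ℝ) 1)).const_mul σ)) (fun t ht => by
        have h1 := (le_abs_self _).trans (h t ht)
        have h2 := hsp t ht
        have h3 : √(φ t) ^ 2 = φ t := Real.sq_sqrt (hφ0 t ht)
        have h4 : φ' t / (2 * √(φ t)) ≤ σ * √(φ t) ^ 2 := by
          rw [div_le_iff₀ (by positivity), h3]
          linarith
        have h5 : φ' t / (2 * √(φ t)) / √(φ t) ^ 2 ≤ σ := by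
          rwa [div_le_iff₀ (by positivity)]
        rw [neg_div]
        linarith)
    have h2 := hm h0 ht ht.1
    simp only [Pi.add_apply, Pi.inv_apply, id, mul_zero, add_zero] at h2
    have hs0 := hsp 0 h0
    have hst := hsp t ht
    have h3 : 0 < 1 - σ * √(φ 0) * t := by
      have : σ * √(φ 0) * t ≤ σ * √(φ 0) :=
        mul_le_of_le_one_right (by positivity) ht.2
      linarith
    rw [le_div_iff₀ h3]
    have h4 := mul_le_mul_of_nonneg_right h2 (mul_pos hs0 hst).le
    have e1 : (√(φ 0))⁻¹ * (√(φ 0) * √(φ t)) = √(φ t) := by field_simp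
    have e2 : ((√(φ t))⁻¹ + σ * t) * (√(φ 0) * √(φ t)) =
        √(φ 0) + σ * t * √(φ 0) * √(φ t) := by field_simp
    have h5 : (√(φ 0))⁻¹ * (√(φ 0) * √(φ t)) ≤ ((√(φ t))⁻¹ + σ * t) * (√(φ 0) * √(φ t)) := by
      simpa using h4
    rw [e1, e2] at h5
    linarith

lemma integral_one_sub_mul_sq (c : ℝ) :
    ∫ t in (0 : ℝ)..1, (1 - c * t) ^ 2 = 1 - c + 1 / 3 * c ^ 2 := by
  have h : ∀ t : ℝ, HasDerivAt (fun t => t - c * t ^ 2 + c ^ 2 * t ^ 3 / 3) ((1 - c * t) ^ 2) t :=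
    fun t => by
      have := ((hasDerivAt_id t).sub ((hasDerivAt_pow 2 t).const_mul c)).add
        (((hasDerivAt_pow 3 t).const_mul (c ^ 2)).div_const 3)
      refine this.congr_deriv ?_
      norm_num
      ring
  rw [intervalIntegral.integral_eq_sub_of_hasDerivAt (fun t _ => h t)
    (Continuous.intervalIntegrable (by fun_prop) _ _)]
  ring

lemma continuousOn_one_div_one_sub_mul_sq {c : ℝ} (hc : c < 1) :
    ContinuousOn (fun t => 1 / (1 - c * t) ^ 2) (Icc (0 : ℝ) 1) := by
  refine ContinuousOn.div continuousOn_const (by fun_prop) fun t ht => pow_ne_zero 2 ?_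
  rcases le_total c 0 with hc' | hc'
  · nlinarith [mul_nonneg (neg_nonneg.2 hc') ht.1]
  · nlinarith [mul_le_mul_of_nonneg_left ht.2 hc']

lemma integral_one_div_one_sub_mul_sq {c : ℝ} (hc : c < 1) :
    ∫ t in (0 : ℝ)..1, 1 / (1 - c * t) ^ 2 = 1 / (1 - c) := by
  have hne : ∀ t ∈ Icc (0 : ℝ) 1, 1 - c * t ≠ 0 := fun t ht => by
    rcases le_total c 0 with hc' | hc'
    · nlinarith [mul_nonneg (neg_nonneg.2 hc') ht.1]
    · nlinarith [mul_le_mul_of_nonneg_left ht.2 hc']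
  have h : ∀ t ∈ uIcc (0 : ℝ) 1,
      -- This primitive, unlike `1 / (c (1 - ct))`, also covers `c = 0`.
      HasDerivAt (fun t => t / (1 - c * t)) (1 / (1 - c * t) ^ 2) t := fun t ht => by
    rw [uIcc_of_le zero_le_one] at ht
    have := (hasDerivAt_id t).div (((hasDerivAt_id t).const_mul c).const_sub 1) (hne t ht)
    refine this.congr_deriv ?_
    have := hne t ht
    simp only [id]
    field_simp
    ring
  rw [intervalIntegral.integral_eq_sub_of_hasDerivAt h
    (ContinuousOn.intervalIntegrable
      (by rw [uIcc_of_le zero_le_one]; exact continuousOn_one_div_one_sub_mul_sq hc))]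
  simp

end Scalar

/-! ### Bounds for the transported Hessian. -/

section Main

variable [FiniteDimensional ℝ E] {cov : AffineConnection E M} [T2Space M]
  [CovariantDerivative.ContMDiffCovariantDerivative cov ∞]
  {C : Set M} {σ : ℝ} {f : M → ℝ} {γ : ℝ → M}

/-- Transported vectors are parallel fields, so the function is even differentiable in `t`;
integrability follows from continuity. -/
lemma continuousOn_transportedHessian (hCo : IsOpen C) (hf : IsSelfConcordant cov C f σ)
    (hγ : IsGeodesic cov γ 0 1) (hγC : MapsTo γ (Icc 0 1) C) (u v : TangentSpace 𝓘(ℝ, E) (γ 0)) :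
    ContinuousOn (fun t => transportedHessian cov f γ t u v) (Icc 0 1) := fun _ ht =>
  have hτ := isParallelTransport_parallelTransport zero_lt_one hγ
  (hasDerivWithinAt_hessian hCo hf.smooth hγ.1 ht (hγC ht) (hτ.2 u) (hτ.2 v)).continuousWithinAt

/-- The bounds for the transported Hessian at each time. -/
lemma transportedHessian_bounds (hCo : IsOpen C) (hσ : 0 ≤ σ) (hf : IsSelfConcordant cov C f σ)
    (hγ : IsGeodesic cov γ 0 1) (hγC : MapsTo γ (Icc 0 1) C) {N : ℝ}
    (hN : N = localNorm cov f (γ 0) (velocity γ (Icc 0 1) 0)) (hlt : σ * N < 1)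
    (u : TangentSpace 𝓘(ℝ, E) (γ 0)) {t : ℝ} (ht : t ∈ Icc (0 : ℝ) 1) :
    (1 - σ * N * t) ^ 2 * hessian cov f (γ 0) u u ≤ transportedHessian cov f γ t u u ∧
      transportedHessian cov f γ t u u ≤
        1 / (1 - σ * N * t) ^ 2 * hessian cov f (γ 0) u u := by
  have hnonneg : ∀ t ∈ Icc (0 : ℝ) 1, ∀ w : TangentSpace 𝓘(ℝ, E) (γ t),
      0 ≤ hessian cov f (γ t) w w := fun t ht w => by
    by_cases hw : w = 0
    · rw [hw, hessian_eq_hessianCoord hCo hf.smooth (mem_chart_source E (γ t)) (hγC ht)]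
      simp
    · exact (hf.nondegenerate _ (hγC ht) w hw).le
  have hτ := isParallelTransport_parallelTransport zero_lt_one hγ
  -- The geodesic equation says that the velocity is parallel, so the derivative formula applies to
  -- it; self-concordance with both vectors equal to `γ̇` closes the inequality for its norm.
  have hsqrt : ∀ t ∈ Icc (0 : ℝ) 1,
      √(hessian cov f (γ t) (velocity γ (Icc 0 1) t) (velocity γ (Icc 0 1) t)) ≤
        N / (1 - σ * N * t) := fun t ht => by
    subst hN
    exact sqrt_le_of_abs_deriv_le hσ
      (fun t ht => hasDerivWithinAt_hessian hCo hf.smooth hγ.1 ht (hγC ht) hγ.2 hγ.2)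
      (fun t ht => hnonneg t ht _) (fun t ht => hf.bound _ (hγC ht) _ _) hlt ht
  -- With the speed bound, self-concordance in direction `γ̇` becomes the differential inequality
  -- with `c = σN`.
  have h := bounds_of_abs_deriv_le hlt
    (fun t ht => hasDerivWithinAt_hessian hCo hf.smooth hγ.1 ht (hγC ht) (hτ.2 u) (hτ.2 u))
    (fun t ht => by
      refine (hf.bound _ (hγC ht) _ _).trans
        (mul_le_mul_of_nonneg_right ?_ (hnonneg t ht _))
      rw [mul_assoc, mul_div_assoc]
      exact mul_le_mul_of_nonneg_left (mul_le_mul_of_nonneg_left (hsqrt t ht) hσ) zero_le_two) ht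
  have h0 : parallelTransport cov γ 0 1 0 u = u := by rw [hτ.1]; rfl
  rw [h0] at h
  exact h

end Main

end SelfConc

end

theorem mainTheorem6
    {E : Type*} [NormedAddCommGroup E] [NormedSpace ℝ E] [FiniteDimensional ℝ E]
    {M : Type*} [TopologicalSpace M] [T2Space M] [SecondCountableTopology M]
    [ChartedSpace E M] [IsManifold 𝓘(ℝ, E) ∞ M]
    (cov : SelfConc.AffineConnection E M)
    [CovariantDerivative.ContMDiffCovariantDerivative cov ∞]
    (htors : SelfConc.IsTorsionFree cov)
    (hexp : SelfConc.ExpDefined cov) (hsurj : SelfConc.ExpSurjective cov)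
    (C : Set M) (hCo : IsOpen C) (hCc : SelfConc.IsGeodConvex cov C)
    (σ : ℝ) (hσ : 0 ≤ σ) (f : M → ℝ) (hf : SelfConc.IsSelfConcordant cov C f σ)
    (γ : ℝ → M) (hγ : SelfConc.IsGeodesic cov γ 0 1) (hγC : MapsTo γ (Icc 0 1) C)
    (N : ℝ) (hN : N = SelfConc.localNorm cov f (γ 0) (SelfConc.velocity γ (Icc 0 1) 0))
    (hW : γ 1 ∈ SelfConc.dikinEllipsoid cov C f (γ 0) (ENNReal.ofReal σ)⁻¹)
    -- `γ` itself is one of the geodesics that witness this membership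
    (hlt : σ * N < 1) :
    (SelfConc.FormLE (fun u v => (1 - σ * N) ^ 2 * SelfConc.hessian cov f (γ 0) u v)
        (SelfConc.transportedHessian cov f γ 1) ∧
      SelfConc.FormLE (SelfConc.transportedHessian cov f γ 1)
        (fun u v => 1 / (1 - σ * N) ^ 2 * SelfConc.hessian cov f (γ 0) u v)) ∧
    (∀ u v : TangentSpace 𝓘(ℝ, E) (γ 0), IntervalIntegrable
      (fun t => SelfConc.transportedHessian cov f γ t u v) volume 0 1) ∧
    (SelfConc.FormLE
        (fun u v => (1 - σ * N + 1 / 3 * σ ^ 2 * N ^ 2) * SelfConc.hessian cov f (γ 0) u v)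
        (fun u v => ∫ t in (0 : ℝ)..1, SelfConc.transportedHessian cov f γ t u v) ∧
      SelfConc.FormLE
        (fun u v => ∫ t in (0 : ℝ)..1, SelfConc.transportedHessian cov f γ t u v)
        (fun u v => 1 / (1 - σ * N) * SelfConc.hessian cov f (γ 0) u v)) := by
  have hb := fun u {t} => SelfConc.transportedHessian_bounds hCo hσ hf hγ hγC hN hlt u (t := t)
  have hint : ∀ u v : TangentSpace 𝓘(ℝ, E) (γ 0), IntervalIntegrable
      (fun t => SelfConc.transportedHessian cov f γ t u v) volume 0 1 := fun u v =>
    ContinuousOn.intervalIntegrable (by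
      rw [uIcc_of_le zero_le_one]
      exact SelfConc.continuousOn_transportedHessian hCo hf hγ hγC u v)
  refine ⟨⟨fun u => ?_, fun u => ?_⟩, hint, fun u => ?_, fun u => ?_⟩
  · simpa using (hb u (right_mem_Icc.2 zero_le_one)).1
  · simpa using (hb u (right_mem_Icc.2 zero_le_one)).2
  -- The pointwise bounds are integrated in `t`; the form at time `0` is a constant factor, and the
  -- weights `(1 - σNt)^{±2}` integrate to the stated constants.
  · have h := intervalIntegral.integral_mono_on zero_le_one
      (Continuous.intervalIntegrable (by fun_prop) _ _) (hint u u) fun t ht => (hb u ht).1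
    rw [intervalIntegral.integral_mul_const, SelfConc.integral_one_sub_mul_sq, mul_pow,
      ← mul_assoc] at h
    exact h
  · have h := intervalIntegral.integral_mono_on zero_le_one (hint u u)
      (ContinuousOn.intervalIntegrable (by
        rw [uIcc_of_le zero_le_one]
        exact (SelfConc.continuousOn_one_div_one_sub_mul_sq hlt).mul continuousOn_const))
      fun t ht => (hb u ht).2
    rw [intervalIntegral.integral_mul_const, SelfConc.integral_one_div_one_sub_mul_sq hlt] at h
    exact h
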